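/- **Setting.** A $W^*$-category is a category whose morphism spaces are complex Banach spaces, with bilinear composition satisfying $\|fg\|\le\|f\|\,\|g\|$, isometric conjugate-linear contravariant involutions $f\mapsto f^*$ satisfying $\|f^*f\|=\|f\|^2$, and such that each morphism space is the dual of a Banach space; the resulting weak-$*$ topologies are called ultraweak. A monoidal $W^*$-category is a $W^*$-category with a monoidal structure whose tensor product is bilinear, compatible with the involutions and separately ultraweakly continuous. It is *concrete* if it comes with a linear, $*$-preserving, ultraweakly continuous strong monoidal functor $\mathrm{For}$, with unitary coherence isomorphisms, to the category of Hilbert spaces and bounded operators with the Hilbert space tensor product. Write $\mathcal H=\mathrm{For}(H)$ etc.; morphisms $X\otimes Y\to X'\otimes Y'$ are regarded, through $\mathrm{For}$ and its coherence isomorphisms, as operators between Hilbert space tensor products. Write $\mathcal B(\mathcal H,\mathcal K)_*$ for the space of normal (ultraweakly continuous) functionals on $\mathcal B(\mathcal H,\mathcal K)$, $\mathcal K(\mathcal H,\mathcal K)$ for the compact operators, and $[\,\cdot\,]$ for the closed linear span. Let $\mathcal C$ be a concrete monoidal $W^*$-category with a braiding $c$ (not assumed symmetric) that is *bi-semi-regular*: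 every $c_{X,Y}$ is unitary and, for all objects $X,Y$, $$\mathcal K(\mathcal X,\mathcal Y)\subseteq[(\mathrm{id}\otimes\omega)(c_{X,Y})\mid\omega\in\mathcal B(\mathcal Y,\mathcal X)_*]\quad\text{and}\quad \mathcal K(\mathcal X,\mathcal Y)\subseteq[(\omega\otimes\mathrm{id})(c_{Y,X})\mid\omega\in\mathcal B(\mathcal Y,\mathcal X)_*].$$ Let $L$ be an object of $\mathcal C$ and let $F:L\otimes L\to L\otimes L$ be a *multiplicative unitary* in $\mathcal C$, i.e. a unitary morphism with $$F_{23}F_{12}=F_{12}\,(c_{L,L}^{-1})_{12}\,F_{23}\,(c_{L,L})_{12}\,F_{23}.$$ Put $A(F):=[(\omega\otimes\mathrm{id})(F)\mid\omega\in\mathcal B(\mathcal L)_*]\subseteq\mathcal B(\mathcal L)$. **Proposition.** 1. $A(F)$ is a subalgebra of $\mathcal B(\mathcal L)$. 2. $A(F)$ acts non-degenerately: $[A(F)\mathcal L]=\mathcal L$. 3. If $F$ is *bi-semi-regular*, i.e. $\mathcal K(\mathcal L)\subseteq[(\mathrm{id}\otimes\omega)(c_{L,L}^{-1}F)\mid\omega\in\mathcal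 B(\mathcal L)_*]$ and $\mathcal K(\mathcal L)\subseteq[(\omega\otimes\mathrm{id})(c_{L,L}F^*)\mid\omega\in\mathcal B(\mathcal L)_*]$, then $A(F)$ is a $C^*$-algebra, i.e. a norm-closed $*$-subalgebra of $\mathcal B(\mathcal L)$. -/

import Mathlib

open CategoryTheory MonoidalCategory
open scoped TensorProduct Topology

noncomputable section

namespace BraidedMU

universe w

section HilbertTensor

variable {E F G E' F' G' E'' F'' M Z : Type*}
  [NormedAddCommGroup E] [InnerProductSpace ℂ E]
  [NormedAddCommGroup F] [InnerProductSpace ℂ F]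
  [NormedAddCommGroup G] [InnerProductSpace ℂ G]
  [NormedAddCommGroup E'] [InnerProductSpace ℂ E']
  [NormedAddCommGroup F'] [InnerProductSpace ℂ F']
  [NormedAddCommGroup G'] [InnerProductSpace ℂ G']
  [NormedAddCommGroup E''] [InnerProductSpace ℂ E'']
  [NormedAddCommGroup F''] [InnerProductSpace ℂ F'']
  [NormedAddCommGroup M] [InnerProductSpace ℂ M]
  [NormedAddCommGroup Z] [NormedSpace ℂ Z]

variable (E F) in
/-- The Hilbert space tensor product: the completion of the algebraic tensor product with respect
to the inner product `⟪x ⊗ y, x' ⊗ y'⟫ = ⟪x, x'⟫ * ⟪y, y'⟫`. -/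
def HTensor := UniformSpace.Completion (E ⊗[ℂ] F)

instance : NormedAddCommGroup (HTensor E F) :=
  inferInstanceAs (NormedAddCommGroup (UniformSpace.Completion (E ⊗[ℂ] F)))

instance : InnerProductSpace ℂ (HTensor E F) :=
  inferInstanceAs (InnerProductSpace ℂ (UniformSpace.Completion (E ⊗[ℂ] F)))

instance : CompleteSpace (HTensor E F) :=
  inferInstanceAs (CompleteSpace (UniformSpace.Completion (E ⊗[ℂ] F)))

variable (E F) in
/-- The inclusion of the algebraic tensor product into its completion. -/
def incl : E ⊗[ℂ] F →ₗᵢ[ℂ] HTensor E F := UniformSpace.Completion.toComplₗᵢ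

lemma denseRange_incl : DenseRange (incl E F) := UniformSpace.Completion.denseRange_coe

variable (E F) in
/-- The bilinear map `(x, y) ↦ x ⊗ y` into the Hilbert space tensor product. -/
def tmulL : E →L[ℂ] F →L[ℂ] HTensor E F :=
  (ContinuousLinearMap.compL ℂ F (E ⊗[ℂ] F) (HTensor E F) (incl E F).toContinuousLinearMap) ∘L
    TensorProduct.mkL ℂ E F

lemma tmulL_apply (x : E) (y : F) : tmulL E F x y = incl E F (x ⊗ₜ[ℂ] y) := rfl

lemma inner_tmulL (x x' : E) (y y' : F) :
    inner ℂ (tmulL E F x y) (tmulL E F x' y') = inner ℂ x x' * inner ℂ y y' := by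
  rw [tmulL_apply, tmulL_apply, LinearIsometry.inner_map_map, TensorProduct.inner_tmul]

lemma htensor_ext {f g : HTensor E F →L[ℂ] Z} (h : ∀ x y, f (tmulL E F x y) = g (tmulL E F x y)) :
    f = g := by
  have : f.toLinearMap ∘ₗ (incl E F).toLinearMap = g.toLinearMap ∘ₗ (incl E F).toLinearMap :=
    TensorProduct.ext' h
  exact ContinuousLinearMap.ext fun t => denseRange_incl.induction_on t
    (isClosed_eq f.continuous g.continuous) fun a => congr($this a)

lemma htensor_ext_right {f g : HTensor E F →L[ℂ] Z}
    (h : ∀ y, f ∘L (tmulL E F).flip y = g ∘L (tmulL E F).flip y) :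
    f = g := htensor_ext fun x y => congr($(h y) x)

/-- The tensor product `f ⊗ g` of bounded operators. -/
def hmap (f : E →L[ℂ] E') (g : F →L[ℂ] F') : HTensor E F →L[ℂ] HTensor E' F' :=
  ContinuousLinearMap.completion (TensorProduct.mapL f g)

@[simp] lemma hmap_tmulL (f : E →L[ℂ] E') (g : F →L[ℂ] F') (x : E) (y : F) :
    hmap f g (tmulL E F x y) = tmulL E' F' (f x) (g y) :=
  ContinuousLinearMap.completion_apply_coe (TensorProduct.mapL f g) (x ⊗ₜ[ℂ] y)

variable (E F G) in
/-- The dense inclusion of the algebraic triple tensor product, bracketed to the left. -/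
def inclLeft : (E ⊗[ℂ] F) ⊗[ℂ] G →ₗᵢ[ℂ] HTensor (HTensor E F) G :=
  (incl (HTensor E F) G).comp (LinearIsometry.rTensor G (incl E F))

variable (E F G) in
/-- The dense inclusion of the algebraic triple tensor product, bracketed to the right. -/
def inclRight : E ⊗[ℂ] (F ⊗[ℂ] G) →ₗᵢ[ℂ] HTensor E (HTensor F G) :=
  (incl E (HTensor F G)).comp (LinearIsometry.lTensor E (incl F G))

lemma htensor_eq_top {S : Submodule ℂ (HTensor E F)} (hS : IsClosed (S : Set (HTensor E F)))
    (h : ∀ x y, tmulL E F x y ∈ S) : S = ⊤ := by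
  refine Submodule.eq_top_iff'.mpr fun t => denseRange_incl.induction_on t hS fun a => ?_
  induction a using TensorProduct.induction_on with
  | zero => rw [map_zero]; exact S.zero_mem
  | tmul x y => exact h x y
  | add a b ha hb => rw [map_add]; exact S.add_mem ha hb

lemma denseRange_inclLeft : DenseRange (inclLeft E F G).toLinearMap := by
  rw [DenseRange, ← LinearMap.coe_range, Submodule.dense_iff_topologicalClosure_eq_top]
  refine htensor_eq_top (Submodule.isClosed_topologicalClosure _) fun t z => ?_
  exact denseRange_incl.induction_on t
    ((Submodule.isClosed_topologicalClosure _).preimage ((tmulL _ _).flip z).continuous)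
    fun a => Submodule.le_topologicalClosure _ ⟨a ⊗ₜ z, rfl⟩

lemma denseRange_inclRight : DenseRange (inclRight E F G).toLinearMap := by
  rw [DenseRange, ← LinearMap.coe_range, Submodule.dense_iff_topologicalClosure_eq_top]
  refine htensor_eq_top (Submodule.isClosed_topologicalClosure _) fun x t => ?_
  exact denseRange_incl.induction_on t
    ((Submodule.isClosed_topologicalClosure _).preimage (tmulL _ _ x).continuous)
    fun a => Submodule.le_topologicalClosure _ ⟨x ⊗ₜ a, rfl⟩

variable (E F G) in
/-- The associator, `(x ⊗ y) ⊗ z ↦ x ⊗ (y ⊗ z)`. -/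
def hassoc : HTensor (HTensor E F) G ≃ₗᵢ[ℂ] HTensor E (HTensor F G) :=
  (TensorProduct.assoc ℂ E F G).extendOfIsometry
    (inclLeft E F G).toLinearMap (inclRight E F G).toLinearMap
    denseRange_inclLeft denseRange_inclRight fun x =>
      (((inclRight E F G).norm_map _).trans (TensorProduct.norm_assoc x)).trans
        ((inclLeft E F G).norm_map x).symm

@[simp] lemma hassoc_tmulL (x : E) (y : F) (z : G) :
    hassoc E F G (tmulL _ _ (tmulL _ _ x y) z) = tmulL _ _ x (tmulL _ _ y z) :=
  LinearEquiv.extendOfIsometry_eq _ _ _ _ _ _ ((x ⊗ₜ[ℂ] y) ⊗ₜ[ℂ] z)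

/-- The one-dimensional Hilbert space `ℂ`, in an arbitrary universe. -/
instance : InnerProductSpace ℂ (ULift.{w} ℂ) where
  inner x y := inner ℂ x.down y.down
  norm_sq_eq_re_inner x := norm_sq_eq_re_inner (𝕜 := ℂ) x.down
  conj_inner_symm x y := inner_conj_symm (𝕜 := ℂ) x.down y.down
  add_left x y z := inner_add_left (𝕜 := ℂ) x.down y.down z.down
  smul_left x y r := inner_smul_left (𝕜 := ℂ) x.down y.down r

variable (E) in
/-- The left unitor, `c ⊗ x ↦ c • x`. -/
def hlid [CompleteSpace E] : HTensor (ULift.{w} ℂ) E ≃ₗᵢ[ℂ] E :=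
  ((TensorProduct.congr ULift.moduleEquiv (LinearEquiv.refl ℂ E)).trans
      (TensorProduct.lid ℂ E)).extendOfIsometry
    (incl _ E).toLinearMap LinearMap.id denseRange_incl Function.surjective_id.denseRange fun x =>
      ((TensorProduct.norm_lid _).trans
        (TensorProduct.norm_map (LinearIsometryEquiv.ulift ℂ ℂ).toLinearIsometry
          LinearIsometry.id x)).trans ((incl _ E).norm_map x).symm

@[simp] lemma hlid_tmulL [CompleteSpace E] (c : ULift.{w} ℂ) (x : E) :
    hlid E (tmulL _ _ c x) = c.down • x :=
  LinearEquiv.extendOfIsometry_eq _ _ _ _ _ _ (c ⊗ₜ[ℂ] x)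

variable (E) in
/-- The right unitor, `x ⊗ c ↦ c • x`. -/
def hrid [CompleteSpace E] : HTensor E (ULift.{w} ℂ) ≃ₗᵢ[ℂ] E :=
  ((TensorProduct.congr (LinearEquiv.refl ℂ E) ULift.moduleEquiv).trans
      (TensorProduct.rid ℂ E)).extendOfIsometry
    (incl E _).toLinearMap LinearMap.id denseRange_incl Function.surjective_id.denseRange fun x =>
      ((TensorProduct.norm_rid _).trans
        (TensorProduct.norm_map LinearIsometry.id
          (LinearIsometryEquiv.ulift ℂ ℂ).toLinearIsometry x)).trans ((incl E _).norm_map x).symm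

@[simp] lemma hrid_tmulL [CompleteSpace E] (x : E) (c : ULift.{w} ℂ) :
    hrid E (tmulL _ _ x c) = c.down • x :=
  LinearEquiv.extendOfIsometry_eq _ _ _ _ _ _ (x ⊗ₜ[ℂ] c)

/-- A unitary operator, as a bounded operator. -/
abbrev uop (e : E ≃ₗᵢ[ℂ] F) : E →L[ℂ] F := e.toContinuousLinearEquiv.toContinuousLinearMap

variable (E F) in
lemma hmap_id : hmap (ContinuousLinearMap.id ℂ E) (ContinuousLinearMap.id ℂ F) =
    ContinuousLinearMap.id ℂ (HTensor E F) :=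
  htensor_ext fun x y => by simp

lemma hmap_comp (f' : E' →L[ℂ] E'') (f : E →L[ℂ] E') (g' : F' →L[ℂ] F'') (g : F →L[ℂ] F') :
    hmap (f' ∘L f) (g' ∘L g) = hmap f' g' ∘L hmap f g :=
  htensor_ext fun x y => by simp

lemma hmap_eq (f : E →L[ℂ] E') (g : F →L[ℂ] F') :
    hmap f g = hmap (ContinuousLinearMap.id ℂ E') g ∘L hmap f (ContinuousLinearMap.id ℂ F) :=
  htensor_ext fun x y => by simp

lemma hassoc_naturality (f : E →L[ℂ] E') (g : F →L[ℂ] F') (h : G →L[ℂ] G') :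
    uop (hassoc E' F' G') ∘L hmap (hmap f g) h = hmap f (hmap g h) ∘L uop (hassoc E F G) :=
  htensor_ext_right fun z => htensor_ext fun x y => by simp

lemma hassoc_pentagon :
    hmap (ContinuousLinearMap.id ℂ E) (uop (hassoc F G M)) ∘L
      (uop (hassoc E (HTensor F G) M) ∘L
        hmap (uop (hassoc E F G)) (ContinuousLinearMap.id ℂ M)) =
    uop (hassoc E F (HTensor G M)) ∘L uop (hassoc (HTensor E F) G M) :=
  htensor_ext_right fun t => htensor_ext_right fun z => htensor_ext fun x y => by simp

lemma hassoc_triangle [CompleteSpace E] [CompleteSpace F] :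
    hmap (ContinuousLinearMap.id ℂ E) (uop (hlid F)) ∘L uop (hassoc E (ULift.{w} ℂ) F) =
      hmap (uop (hrid E)) (ContinuousLinearMap.id ℂ F) :=
  htensor_ext_right fun y => htensor_ext fun x c => by simp

lemma hlid_naturality [CompleteSpace E] [CompleteSpace F] (f : E →L[ℂ] F) :
    uop (hlid F) ∘L hmap (ContinuousLinearMap.id ℂ (ULift.{w} ℂ)) f = f ∘L uop (hlid E) :=
  htensor_ext fun c x => by simp

lemma hrid_naturality [CompleteSpace E] [CompleteSpace F] (f : E →L[ℂ] F) :
    uop (hrid F) ∘L hmap f (ContinuousLinearMap.id ℂ (ULift.{w} ℂ)) = f ∘L uop (hrid E) :=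
  htensor_ext fun x c => by simp

end HilbertTensor

/-- A complex Hilbert space, as an object of the category of Hilbert spaces. -/
structure HilbCat where
  /-- the underlying type -/
  carrier : Type w
  [normedAddCommGroup : NormedAddCommGroup carrier]
  [innerProductSpace : InnerProductSpace ℂ carrier]
  [completeSpace : CompleteSpace carrier]

namespace HilbCat

instance : CoeSort HilbCat.{w} (Type w) := ⟨carrier⟩

attribute [instance] normedAddCommGroup innerProductSpace completeSpace

/-- A morphism of Hilbert spaces is a bounded linear operator. -/
@[ext] structure Hom (H K : HilbCat.{w}) where
  /-- the underlying bounded operator -/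
  operator : H →L[ℂ] K

instance : Category HilbCat.{w} where
  Hom := Hom
  id H := ⟨ContinuousLinearMap.id ℂ H⟩
  comp f g := ⟨g.operator ∘L f.operator⟩

/-- The bounded operator underlying a morphism in the category of Hilbert spaces. -/
abbrev operator {H K : HilbCat.{w}} (f : H ⟶ K) : H →L[ℂ] K := Hom.operator f

/-- A bounded operator, as a morphism in the category of Hilbert spaces. -/
abbrev ofOp {H K : HilbCat.{w}} (f : H →L[ℂ] K) : H ⟶ K := Hom.mk f

/-- A unitary operator gives an isomorphism in the category of Hilbert spaces. -/
def isoOfUnitary {H K : HilbCat.{w}} (e : H ≃ₗᵢ[ℂ] K) : H ≅ K where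
  hom := ofOp (uop e)
  inv := ofOp (uop e.symm)
  hom_inv_id := Hom.ext (ContinuousLinearMap.ext fun x => e.symm_apply_apply x)
  inv_hom_id := Hom.ext (ContinuousLinearMap.ext fun x => e.apply_symm_apply x)

/-- The monoidal structure on Hilbert spaces given by the completed tensor product. -/
instance : MonoidalCategoryStruct HilbCat.{w} where
  tensorObj H K := ⟨HTensor H K⟩
  tensorHom f g := ofOp (hmap (operator f) (operator g))
  whiskerLeft H _ _ f := ofOp (hmap (ContinuousLinearMap.id ℂ H) (operator f))
  whiskerRight f H := ofOp (hmap (operator f) (ContinuousLinearMap.id ℂ H))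
  tensorUnit := ⟨ULift.{w} ℂ⟩
  associator H K M := isoOfUnitary (hassoc H K M)
  leftUnitor H := isoOfUnitary (hlid H)
  rightUnitor H := isoOfUnitary (hrid H)

instance : MonoidalCategory HilbCat.{w} where
  tensorHom_def f g := Hom.ext <| hmap_eq (operator f) (operator g)
  id_tensorHom_id H K := Hom.ext <| hmap_id H K
  tensorHom_comp_tensorHom f₁ f₂ g₁ g₂ := Hom.ext <|
    (hmap_comp (operator g₁) (operator f₁) (operator g₂) (operator f₂)).symm
  whiskerLeft_id H K := Hom.ext <| hmap_id H K
  id_whiskerRight H K := Hom.ext <| hmap_id H K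
  associator_naturality f₁ f₂ f₃ := Hom.ext <|
    hassoc_naturality (operator f₁) (operator f₂) (operator f₃)
  leftUnitor_naturality f := Hom.ext <| hlid_naturality (operator f)
  rightUnitor_naturality f := Hom.ext <| hrid_naturality (operator f)
  pentagon W X Y Z := Hom.ext <| hassoc_pentagon (E := W) (F := X) (G := Y) (M := Z)
  triangle X Y := Hom.ext <| hassoc_triangle (E := X) (F := Y)

end HilbCat

section Slices

set_option linter.unusedSectionVars false

variable {E F E' F' S S' : Type*}
  [NormedAddCommGroup E] [InnerProductSpace ℂ E] [CompleteSpace E]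
  [NormedAddCommGroup F] [InnerProductSpace ℂ F] [CompleteSpace F]
  [NormedAddCommGroup E'] [InnerProductSpace ℂ E'] [CompleteSpace E']
  [NormedAddCommGroup F'] [InnerProductSpace ℂ F'] [CompleteSpace F']
  [NormedAddCommGroup S] [InnerProductSpace ℂ S] [CompleteSpace S]
  [NormedAddCommGroup S'] [InnerProductSpace ℂ S'] [CompleteSpace S']

/-- `ω` belongs to the predual `B(E, E')_*`, i.e. `ω(T) = ∑ₙ ⟪ηₙ, T ξₙ⟫` for some square-summable
sequences `ξ` in `E` and `η` in `E'`. -/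
def IsNormalFunctional (ω : (E →L[ℂ] E') →L[ℂ] ℂ) : Prop :=
  ∃ (ξ : ℕ → E) (η : ℕ → E'), Summable (fun n => ‖ξ n‖ ^ 2) ∧ Summable (fun n => ‖η n‖ ^ 2) ∧
    ∀ T : E →L[ℂ] E', HasSum (fun n => inner ℂ (η n) (T (ξ n))) (ω T)

variable (E E') in
/-- The ultraweak topology on `B(E, E')`: the weakest topology making all functionals in the
predual `B(E, E')_*` continuous. -/
@[reducible] def ultraweakTopology : TopologicalSpace (E →L[ℂ] E') :=
  ⨅ (ω : (E →L[ℂ] E') →L[ℂ] ℂ) (_ : IsNormalFunctional ω), TopologicalSpace.induced ω inferInstance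

/-- The bounded operator `T : F → F'` with `⟪η, T ξ⟫ = ω((j' η)† ∘ X ∘ (j ξ))`,
see `inner_slice`. -/
def slice (ω : (E →L[ℂ] E') →L[ℂ] ℂ) (j : F →L[ℂ] E →L[ℂ] S) (j' : F' →L[ℂ] E' →L[ℂ] S')
    (X : S →L[ℂ] S') : F →L[ℂ] F' :=
  let φ : (S' →L[ℂ] E') →L[ℂ] StrongDual ℂ F :=
    (ContinuousLinearMap.compL ℂ F (E →L[ℂ] E') ℂ ω) ∘L
      (((ContinuousLinearMap.compL ℂ F (E →L[ℂ] S) (E →L[ℂ] E')).flip j) ∘L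
        ((ContinuousLinearMap.compL ℂ E S E') ∘L
          ((ContinuousLinearMap.compL ℂ S S' E').flip X)))
  let a : F' →L⋆[ℂ] (S' →L[ℂ] E') :=
    (ContinuousLinearMap.adjoint (𝕜 := ℂ) (E := E') (F := S') :
      (E' →L[ℂ] S') →L⋆[ℂ] (S' →L[ℂ] E')).comp j'
  let r : F' →L[ℂ] F :=
    ((InnerProductSpace.toDual ℂ F).symm : StrongDual ℂ F →L⋆[ℂ] F).comp (φ.comp a)
  ContinuousLinearMap.adjoint r

lemma inner_slice (ω : (E →L[ℂ] E') →L[ℂ] ℂ) (j : F →L[ℂ] E →L[ℂ] S)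
    (j' : F' →L[ℂ] E' →L[ℂ] S') (X : S →L[ℂ] S') (η : F') (ξ : F) :
    inner ℂ η (slice ω j j' X ξ) =
      ω (ContinuousLinearMap.adjoint (j' η) ∘L X ∘L j ξ) := by
  rw [slice, ContinuousLinearMap.adjoint_inner_right]
  exact InnerProductSpace.toDual_symm_apply

/-- The slice `(ω ⊗ id)(X) : F → F'` of an operator `X : E ⊗ F → E' ⊗ F'`. -/
def leftSlice (ω : (E →L[ℂ] E') →L[ℂ] ℂ) (X : HTensor E F →L[ℂ] HTensor E' F') : F →L[ℂ] F' :=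
  slice ω (tmulL E F).flip (tmulL E' F').flip X

/-- The slice `(id ⊗ ω)(X) : E → E'` of an operator `X : E ⊗ F → E' ⊗ F'`. -/
def rightSlice (ω : (F →L[ℂ] F') →L[ℂ] ℂ) (X : HTensor E F →L[ℂ] HTensor E' F') : E →L[ℂ] E' :=
  slice ω (tmulL E F) (tmulL E' F') X

/-- `[(ω ⊗ id)(X) | ω ∈ B(E, E')_*]`, a norm-closed linear subspace of `B(F, F')`. -/
def leftSlices (X : HTensor E F →L[ℂ] HTensor E' F') : Submodule ℂ (F →L[ℂ] F') :=
  (Submodule.span ℂ {T | ∃ ω : (E →L[ℂ] E') →L[ℂ] ℂ,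
    IsNormalFunctional ω ∧ T = leftSlice ω X}).topologicalClosure

/-- `[(id ⊗ ω)(X) | ω ∈ B(F, F')_*]`, a norm-closed linear subspace of `B(E, E')`. -/
def rightSlices (X : HTensor E F →L[ℂ] HTensor E' F') : Submodule ℂ (E →L[ℂ] E') :=
  (Submodule.span ℂ {T | ∃ ω : (F →L[ℂ] F') →L[ℂ] ℂ,
    IsNormalFunctional ω ∧ T = rightSlice ω X}).topologicalClosure

end Slices

section WStar

universe v u

/-- A `C⋆`-category: the morphism spaces are complex Banach spaces, composition is bilinear and
submultiplicative, and there are isometric conjugate-linear contravariant involutions satisfying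
the `C⋆`-identity. -/
class CStarCategory (C : Type u) [Category.{v} C] where
  [normedAddCommGroup : ∀ X Y : C, NormedAddCommGroup (X ⟶ Y)]
  [normedSpace : ∀ X Y : C, NormedSpace ℂ (X ⟶ Y)]
  [completeSpace : ∀ X Y : C, CompleteSpace (X ⟶ Y)]
  add_comp : ∀ {X Y Z : C} (f f' : X ⟶ Y) (g : Y ⟶ Z), (f + f') ≫ g = f ≫ g + f' ≫ g
  comp_add : ∀ {X Y Z : C} (f : X ⟶ Y) (g g' : Y ⟶ Z), f ≫ (g + g') = f ≫ g + f ≫ g'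
  smul_comp : ∀ {X Y Z : C} (a : ℂ) (f : X ⟶ Y) (g : Y ⟶ Z), (a • f) ≫ g = a • (f ≫ g)
  comp_smul : ∀ {X Y Z : C} (a : ℂ) (f : X ⟶ Y) (g : Y ⟶ Z), f ≫ (a • g) = a • (f ≫ g)
  norm_comp_le : ∀ {X Y Z : C} (f : X ⟶ Y) (g : Y ⟶ Z), ‖f ≫ g‖ ≤ ‖g‖ * ‖f‖
  /-- the involution `f ↦ f⋆` -/
  adj : ∀ {X Y : C}, (X ⟶ Y) → (Y ⟶ X)
  adj_adj : ∀ {X Y : C} (f : X ⟶ Y), adj (adj f) = f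
  adj_add : ∀ {X Y : C} (f g : X ⟶ Y), adj (f + g) = adj f + adj g
  adj_smul : ∀ {X Y : C} (a : ℂ) (f : X ⟶ Y), adj (a • f) = star a • adj f
  adj_comp : ∀ {X Y Z : C} (f : X ⟶ Y) (g : Y ⟶ Z), adj (f ≫ g) = adj g ≫ adj f
  norm_adj : ∀ {X Y : C} (f : X ⟶ Y), ‖adj f‖ = ‖f‖
  norm_comp_adj : ∀ {X Y : C} (f : X ⟶ Y), ‖f ≫ adj f‖ = ‖f‖ ^ 2

attribute [reducible, instance] CStarCategory.normedAddCommGroup CStarCategory.normedSpace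

attribute [instance]
  CStarCategory.completeSpace

open CStarCategory

/-- A `W⋆`-category: a `C⋆`-category each of whose morphism spaces is the dual of a Banach space. -/
class WStarCategory (C : Type u) [Category.{v} C] extends CStarCategory C where
  /-- the predual of the space of morphisms `X ⟶ Y` -/
  Predual : C → C → Type v
  [predualNormedAddCommGroup : ∀ X Y : C, NormedAddCommGroup (Predual X Y)]
  [predualNormedSpace : ∀ X Y : C, NormedSpace ℂ (Predual X Y)]
  [predualCompleteSpace : ∀ X Y : C, CompleteSpace (Predual X Y)]
  /-- the identification of the space of morphisms with the dual of the predual -/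
  dualEquiv : ∀ X Y : C, (X ⟶ Y) ≃ₗᵢ[ℂ] StrongDual ℂ (Predual X Y)

attribute [reducible, instance] WStarCategory.predualNormedAddCommGroup
  WStarCategory.predualNormedSpace

attribute [instance]
  WStarCategory.predualCompleteSpace

/-- The ultraweak topology on a morphism space of a `W⋆`-category: the weak topology induced by
the predual. -/
@[reducible] def WStarCategory.ultraweak {C : Type u} [Category.{v} C] [WStarCategory C] (X Y : C) :
    TopologicalSpace (X ⟶ Y) :=
  TopologicalSpace.induced (fun (f : X ⟶ Y) (p : Predual X Y) => dualEquiv X Y f p)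
    Pi.topologicalSpace

open WStarCategory

/-- A monoidal `W⋆`-category: a `W⋆`-category with a monoidal structure whose tensor product is
bilinear, compatible with the involution, and normal in each variable. -/
class MonoidalWStarCategory (C : Type u) [Category.{v} C] [MonoidalCategory C] extends
    WStarCategory C where
  add_tensorHom : ∀ {X X' Y Y' : C} (f f' : X ⟶ X') (g : Y ⟶ Y'),
    (f + f') ⊗ₘ g = f ⊗ₘ g + f' ⊗ₘ g
  tensorHom_add : ∀ {X X' Y Y' : C} (f : X ⟶ X') (g g' : Y ⟶ Y'),
    f ⊗ₘ (g + g') = f ⊗ₘ g + f ⊗ₘ g'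
  smul_tensorHom : ∀ {X X' Y Y' : C} (a : ℂ) (f : X ⟶ X') (g : Y ⟶ Y'),
    (a • f) ⊗ₘ g = a • (f ⊗ₘ g)
  tensorHom_smul : ∀ {X X' Y Y' : C} (a : ℂ) (f : X ⟶ X') (g : Y ⟶ Y'),
    f ⊗ₘ (a • g) = a • (f ⊗ₘ g)
  adj_tensorHom : ∀ {X X' Y Y' : C} (f : X ⟶ X') (g : Y ⟶ Y'),
    adj (f ⊗ₘ g) = adj f ⊗ₘ adj g
  normal_tensorHom_left : ∀ {X X' Y Y' : C} (g : Y ⟶ Y'),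
    Continuous[ultraweak X X', ultraweak (X ⊗ Y) (X' ⊗ Y')] fun f => f ⊗ₘ g
  normal_tensorHom_right : ∀ {X X' Y Y' : C} (f : X ⟶ X'),
    Continuous[ultraweak Y Y', ultraweak (X ⊗ Y) (X' ⊗ Y')] fun g => f ⊗ₘ g

/-- A normal strong monoidal functor from a monoidal `W⋆`-category to the category of Hilbert
spaces, compatible with the linear structures and the involutions, and with unitary coherence
isomorphisms. A monoidal `W⋆`-category together with such a functor is a concrete monoidal
`W⋆`-category. -/
structure FibreFunctor (C : Type u) [Category.{v} C] [MonoidalCategory C]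
    [MonoidalWStarCategory C] where
  /-- the underlying functor -/
  functor : C ⥤ HilbCat.{w}
  /-- the strong monoidal structure -/
  [monoidal : functor.Monoidal]
  map_add : ∀ {X Y : C} (f g : X ⟶ Y),
    HilbCat.operator (functor.map (f + g)) =
      HilbCat.operator (functor.map f) + HilbCat.operator (functor.map g)
  map_smul : ∀ {X Y : C} (a : ℂ) (f : X ⟶ Y),
    HilbCat.operator (functor.map (a • f)) = a • HilbCat.operator (functor.map f)
  map_adj : ∀ {X Y : C} (f : X ⟶ Y),
    HilbCat.operator (functor.map (adj f)) =
      ContinuousLinearMap.adjoint (HilbCat.operator (functor.map f))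
  normal : ∀ X Y : C,
    Continuous[ultraweak X Y, ultraweakTopology (functor.obj X) (functor.obj Y)]
      fun f => HilbCat.operator (functor.map f)
  adjoint_μ : ∀ X Y : C,
    ContinuousLinearMap.adjoint (HilbCat.operator (Functor.LaxMonoidal.μ functor X Y)) =
      HilbCat.operator (Functor.OplaxMonoidal.δ functor X Y)
  adjoint_ε :
    ContinuousLinearMap.adjoint (HilbCat.operator (Functor.LaxMonoidal.ε functor)) =
      HilbCat.operator (Functor.OplaxMonoidal.η functor)

attribute [instance] FibreFunctor.monoidal

variable {C : Type u} [Category.{v} C] [MonoidalCategory C] [MonoidalWStarCategory C]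

/-- The Hilbert space underlying an object. -/
abbrev FibreFunctor.space (U : FibreFunctor.{w} C) (X : C) : Type w := U.functor.obj X

/-- The operator on Hilbert space tensor products underlying a morphism `X ⊗ Y ⟶ X' ⊗ Y'`. -/
def FibreFunctor.onTensor (U : FibreFunctor.{w} C) {X Y X' Y' : C} (f : X ⊗ Y ⟶ X' ⊗ Y') :
    HTensor (U.space X) (U.space Y) →L[ℂ] HTensor (U.space X') (U.space Y') :=
  HilbCat.operator (Functor.LaxMonoidal.μ U.functor X Y ≫ U.functor.map f ≫
    Functor.OplaxMonoidal.δ U.functor X' Y')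

/-- A unitary morphism. -/
def IsUnitaryHom {X Y : C} (f : X ⟶ Y) : Prop := f ≫ adj f = 𝟙 X ∧ adj f ≫ f = 𝟙 Y

variable [BraidedCategory C]

/-- Semi-regularity of the braiding: it is unitary, and every compact operator from (the Hilbert
space of) `X` to (that of) `Y` belongs to `[(id ⊗ ω)(c_{X,Y})]`. -/
structure IsSemiRegularBraiding (U : FibreFunctor.{w} C) : Prop where
  unitary : ∀ X Y : C, IsUnitaryHom (β_ X Y).hom
  compact_mem : ∀ (X Y : C) (T : U.space X →L[ℂ] U.space Y), IsCompactOperator T →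
    T ∈ rightSlices (U.onTensor (β_ X Y).hom)

/-- Bi-semi-regularity of the braiding: it is semi-regular, and it is semi-regular for the opposite
tensor product. For the latter, `X ⊗ᵒᵖ Y = Y ⊗ X`, the braiding `X ⊗ᵒᵖ Y ⟶ Y ⊗ᵒᵖ X` is
`c_{Y,X}`, and slicing over the second leg becomes slicing over the first leg. -/
structure IsBiSemiRegularBraiding (U : FibreFunctor.{w} C) : Prop extends
    IsSemiRegularBraiding U where
  compact_mem_op : ∀ (X Y : C) (T : U.space X →L[ℂ] U.space Y), IsCompactOperator T →
    T ∈ leftSlices (U.onTensor (β_ Y X).hom)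

/-- The operator `F ⊗ id` on `(L ⊗ L) ⊗ L`. -/
def leg₁₂ {L : C} (F : L ⊗ L ⟶ L ⊗ L) : (L ⊗ L) ⊗ L ⟶ (L ⊗ L) ⊗ L := F ▷ L

/-- The operator `id ⊗ F` on `(L ⊗ L) ⊗ L`. -/
def leg₂₃ {L : C} (F : L ⊗ L ⟶ L ⊗ L) : (L ⊗ L) ⊗ L ⟶ (L ⊗ L) ⊗ L :=
  (α_ L L L).hom ≫ L ◁ F ≫ (α_ L L L).inv

/-- A multiplicative unitary: a unitary endomorphism of `L ⊗ L` satisfying the braided Pentagon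
equation `F₂₃ F₁₂ = F₁₂ (c⁻¹)₁₂ F₂₃ c₁₂ F₂₃`. (The categorical composition `f ≫ g` is `g ∘ f`.) -/
structure IsMultiplicativeUnitary {L : C} (F : L ⊗ L ⟶ L ⊗ L) : Prop where
  unitary : IsUnitaryHom F
  pentagon : leg₁₂ F ≫ leg₂₃ F =
    leg₂₃ F ≫ leg₁₂ (β_ L L).hom ≫ leg₂₃ F ≫ leg₁₂ (β_ L L).inv ≫ leg₁₂ F

/-- Bi-semi-regularity of a multiplicative unitary `F`: every compact operator belongs to
`C(F) = [(id ⊗ ω)(c⁻¹ ∘ F)]` (`F` is semi-regular), and to `[(ω ⊗ id)(c ∘ F⋆)]` (`F⋆` is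
semi-regular for the opposite tensor product and the inverse braiding). -/
structure IsBiSemiRegular (U : FibreFunctor.{w} C) {L : C} (F : L ⊗ L ⟶ L ⊗ L) : Prop where
  compact_mem : ∀ T : U.space L →L[ℂ] U.space L, IsCompactOperator T →
    T ∈ rightSlices (U.onTensor (F ≫ (β_ L L).inv))
  compact_mem_op : ∀ T : U.space L →L[ℂ] U.space L, IsCompactOperator T →
    T ∈ leftSlices (U.onTensor (adj F ≫ (β_ L L).hom))

/-- `A(F) = [(ω ⊗ id)(F) | ω ∈ B(L)_*]`. -/
def legAlgebra (U : FibreFunctor.{w} C) {L : C} (F : L ⊗ L ⟶ L ⊗ L) :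
    Submodule ℂ (U.space L →L[ℂ] U.space L) :=
  leftSlices (U.onTensor F)

end WStar

end BraidedMU

end

/-!
On the Hilbert space `H` of `L`, let `f` and `c` be the unitaries on `H ⊗ H` underlying the
multiplicative unitary and the braiding, and use the leg numbering on `H ⊗ H ⊗ H`. A slice by a
normal functional is a norm-convergent series of slices by vector functionals, so `A(f)` is the
closed span of the slices `⟪η| f |ξ⟫` over the first leg (`leftSlices_le`). Three rules govern
slices over the first two legs:

* factors acting on these two legs at the outer ends do not matter
  (`leftSlices_opLeg₁₂_mul_le`);
* slicing `x₂₃ z₁₂ y₂₃` over the first leg first gives slices of `x (k ⊗ id) y`, where `k` is a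
  slice of `z` (`vectorSlice_sandwich`);
* if every operator of rank one is a slice of `z`, then `k = |ζ⟫⟪ζ'|` is allowed, and the products
  of slices of `x` and slices of `y` are slices of `x₂₃ z₁₂ y₂₃` (`mul_mem_of_leftSlices_le`).

The pentagon equation `f₂₃ f₁₂ = f₁₂ c₁₂⁻¹ f₂₃ c₁₂ f₂₃` reads `f₂₃ c₁₂ f₂₃ = c₁₂ f₁₂⁻¹ f₂₃ f₁₂`.
As the slices of `c` contain the compact operators, `A(f)` is an algebra. It acts non-degenerately
since `f` is unitary.

For the involution, let `q = f c⁻¹` and let `Q` be its space of slices, which contains the compact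
operators if `f` is bi-semi-regular. By naturality of the braiding and the braid relation, the
pentagon equation is equivalent to `q₂₃ c₁₂⁻¹ q₂₃ = q₁₂ q₂₃ q₁₂` (`braided_pentagon_mul_inv`).
Hence `q₂₃⁻¹ q₁₂ q₂₃ = c₁₂⁻¹ q₂₃ q₁₂⁻¹` and `q₂₃ q₁₂⁻¹ q₂₃⁻¹ = c₁₂ q₂₃⁻¹ q₁₂`, which give
`Q⋆ Q ⊆ Q` and `Q Q⋆ ⊆ Q⋆`. Since `Q` is closed, this forces `Q = Q⋆`
(`star_mem_of_star_mul_mem`). Finally, `f₂₃⁻¹ q₁₂⁻¹ f₂₃ = c₁₂ f₂₃ f₁₂⁻¹` identifies `A(f)` with the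
closed span of the slices of `f⁻¹ (k ⊗ id) f` for `k ∈ Q⋆ = Q`, which is selfadjoint.
-/

namespace BraidedMU

open ContinuousLinearMap InnerProductSpace

/-! ### Vector slices -/

section VectorSlices

set_option linter.unusedSectionVars false

variable {E E₁ E₂ F : Type*}
  [NormedAddCommGroup E] [InnerProductSpace ℂ E] [CompleteSpace E]
  [NormedAddCommGroup E₁] [InnerProductSpace ℂ E₁] [CompleteSpace E₁]
  [NormedAddCommGroup E₂] [InnerProductSpace ℂ E₂] [CompleteSpace E₂]
  [NormedAddCommGroup F] [InnerProductSpace ℂ F] [CompleteSpace F]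

/-- The slice `(ω ⊗ id)(X)` for the vector functional `ω(T) = ⟪η, T ξ⟫`. -/
noncomputable def vectorSlice (η ξ : E) (X : HTensor E F →L[ℂ] HTensor E F) : F →L[ℂ] F :=
  adjoint (tmulL E F η) ∘L X ∘L tmulL E F ξ

lemma inner_vectorSlice (η ξ : E) (X : HTensor E F →L[ℂ] HTensor E F) (y x : F) :
    inner ℂ y (vectorSlice η ξ X x) = inner ℂ (tmulL E F η y) (X (tmulL E F ξ x)) := by
  simp [vectorSlice, adjoint_inner_right]

lemma norm_tmulL_apply_le (x : E) : ‖tmulL E F x‖ ≤ ‖x‖ := by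
  refine opNorm_le_bound _ (norm_nonneg _) fun y => le_of_eq ?_
  rw [tmulL_apply, LinearIsometry.norm_map, TensorProduct.norm_tmul]

lemma norm_vectorSlice_le (η ξ : E) (X : HTensor E F →L[ℂ] HTensor E F) :
    ‖vectorSlice η ξ X‖ ≤ ‖X‖ * (‖η‖ * ‖ξ‖) := by
  calc ‖vectorSlice η ξ X‖ ≤ ‖adjoint (tmulL E F η)‖ * (‖X‖ * ‖tmulL E F ξ‖) :=
        (opNorm_comp_le _ _).trans (by gcongr; exact opNorm_comp_le _ _)
    _ ≤ ‖η‖ * (‖X‖ * ‖ξ‖) := by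
        rw [LinearIsometryEquiv.norm_map]
        gcongr <;> exact norm_tmulL_apply_le _
    _ = _ := by ring

/-- The vector slice `(ω ⊗ id)(X)` as a bounded linear function of `X`. -/
noncomputable def vectorSliceL (η ξ : E) : (HTensor E F →L[ℂ] HTensor E F) →L[ℂ] (F →L[ℂ] F) :=
  LinearMap.mkContinuous
    { toFun := vectorSlice η ξ
      map_add' := fun X Y => by simp [vectorSlice, comp_add]
      map_smul' := fun c X => by simp [vectorSlice] }
    (‖η‖ * ‖ξ‖) fun X => (norm_vectorSlice_le η ξ X).trans_eq (mul_comm _ _)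

lemma adjoint_vectorSlice (η ξ : E) (X : HTensor E F →L[ℂ] HTensor E F) :
    adjoint (vectorSlice η ξ X) = vectorSlice ξ η (adjoint X) := by
  simp [vectorSlice, adjoint_comp, comp_assoc]

/-- A slice by a normal functional is a norm-convergent series of slices by vector functionals. -/
lemma hasSum_vectorSlice {ω : (E →L[ℂ] E) →L[ℂ] ℂ} {ξ η : ℕ → E}
    (hξ : Summable fun n => ‖ξ n‖ ^ 2) (hη : Summable fun n => ‖η n‖ ^ 2)
    (hω : ∀ T : E →L[ℂ] E, HasSum (fun n => inner ℂ (η n) (T (ξ n))) (ω T))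
    (X : HTensor E F →L[ℂ] HTensor E F) :
    HasSum (fun n => vectorSlice (η n) (ξ n) X) (leftSlice ω X) := by
  have hs : Summable fun n => vectorSlice (η n) (ξ n) X := by
    refine .of_norm_bounded ((hη.add hξ).mul_left ‖X‖) fun n =>
      (norm_vectorSlice_le _ _ _).trans ?_
    gcongr
    nlinarith [sq_nonneg (‖η n‖ - ‖ξ n‖), sq_nonneg ‖η n‖, sq_nonneg ‖ξ n‖]
  convert! hs.hasSum
  refine ext fun x => ext_inner_left ℂ fun y => ?_
  have h₁ := (hs.hasSum.mapL (ContinuousLinearMap.apply ℂ F x)).mapL (innerSL ℂ y)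
  simp only [apply_apply, innerSL_apply_apply, inner_vectorSlice] at h₁
  have h₂ := hω (adjoint ((tmulL E F).flip y) ∘L X ∘L (tmulL E F).flip x)
  simp only [ContinuousLinearMap.comp_apply, adjoint_inner_right, flip_apply] at h₂
  rw [leftSlice, inner_slice]
  exact h₂.unique h₁

lemma vectorSlice_mem_leftSlices (η ξ : E) (X : HTensor E F →L[ℂ] HTensor E F) :
    vectorSlice η ξ X ∈ leftSlices X := by
  refine Submodule.le_topologicalClosure _ (Submodule.subset_span ?_)
  -- the vector functional, as a series with a single nonzero term
  let ω : (E →L[ℂ] E) →L[ℂ] ℂ := innerSL ℂ η ∘L ContinuousLinearMap.apply ℂ E ξ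
  have hsq (ζ : E) : Summable fun n => ‖(Pi.single 0 ζ : ℕ → E) n‖ ^ 2 :=
    summable_of_ne_finset_zero (s := {0}) fun n hn => by
      rw [Pi.single_eq_of_ne (by simpa using hn)]; simp
  have hω (T : E →L[ℂ] E) : HasSum (fun n => inner ℂ ((Pi.single 0 η : ℕ → E) n)
      (T ((Pi.single 0 ξ : ℕ → E) n))) (ω T) := by
    have h := hasSum_single (f := fun n => inner ℂ ((Pi.single 0 η : ℕ → E) n)
      (T ((Pi.single 0 ξ : ℕ → E) n))) 0 fun n hn => by
        rw [Pi.single_eq_of_ne hn]; simp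
    simpa [ω] using h
  refine ⟨ω, ⟨_, _, hsq ξ, hsq η, hω⟩, ?_⟩
  have h₁ := hasSum_vectorSlice (hsq ξ) (hsq η) hω X
  have h₂ := hasSum_single (f := fun n => vectorSlice ((Pi.single 0 η : ℕ → E) n)
      ((Pi.single 0 ξ : ℕ → E) n) X) 0 fun n hn => by
    rw [Pi.single_eq_of_ne hn]; simp [vectorSlice]
  simpa using h₂.unique h₁

lemma leftSlices_le {X : HTensor E F →L[ℂ] HTensor E F} {W : Submodule ℂ (F →L[ℂ] F)}
    (hW : IsClosed (W : Set (F →L[ℂ] F))) (h : ∀ η ξ, vectorSlice η ξ X ∈ W) :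
    leftSlices X ≤ W := by
  refine Submodule.topologicalClosure_minimal _ (Submodule.span_le.mpr ?_) hW
  rintro _ ⟨ω, ⟨ξ, η, hξ, hη, hω⟩, rfl⟩
  exact hW.mem_of_tendsto (hasSum_vectorSlice hξ hη hω X)
    (Filter.Eventually.of_forall fun s => W.sum_mem fun n _ => h _ _)

lemma isClosed_leftSlices (X : HTensor E F →L[ℂ] HTensor E F) :
    IsClosed (leftSlices X : Set (F →L[ℂ] F)) :=
  Submodule.isClosed_topologicalClosure _

/-- To slice over a tensor product, it suffices to use elementary tensors. -/
lemma leftSlices_le_of_tmul {X : HTensor (HTensor E₁ E₂) F →L[ℂ] HTensor (HTensor E₁ E₂) F}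
    {W : Submodule ℂ (F →L[ℂ] F)} (hW : IsClosed (W : Set (F →L[ℂ] F)))
    (h : ∀ η₁ η₂ ξ₁ ξ₂, vectorSlice (tmulL E₁ E₂ η₁ η₂) (tmulL E₁ E₂ ξ₁ ξ₂) X ∈ W) :
    leftSlices X ≤ W := by
  have hξ (η₁ η₂ ξ) : vectorSlice (tmulL E₁ E₂ η₁ η₂) ξ X ∈ W := by
    let S : Submodule ℂ (HTensor E₁ E₂) :=
      { carrier := {ξ | vectorSlice (tmulL E₁ E₂ η₁ η₂) ξ X ∈ W}
        zero_mem' := by simp [vectorSlice]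
        add_mem' := fun {a b} ha hb => by
          simpa [vectorSlice, comp_add] using W.add_mem ha hb
        smul_mem' := fun c a ha => by
          simpa [vectorSlice] using W.smul_mem c ha }
    have hS : IsClosed (S : Set (HTensor E₁ E₂)) :=
      hW.preimage (f := fun ξ => vectorSlice (tmulL E₁ E₂ η₁ η₂) ξ X)
        (by unfold vectorSlice; fun_prop)
    exact Submodule.eq_top_iff'.mp (htensor_eq_top hS fun ξ₁ ξ₂ => h η₁ η₂ ξ₁ ξ₂) ξ
  have hη (η ξ) : vectorSlice η ξ X ∈ W := by
    let S : Submodule ℂ (HTensor E₁ E₂) :=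
      { carrier := {η | vectorSlice η ξ X ∈ W}
        zero_mem' := by simp [vectorSlice]
        add_mem' := fun {a b} ha hb => by
          simpa [vectorSlice, add_comp] using W.add_mem ha hb
        smul_mem' := fun c a ha => by
          have : vectorSlice (c • a) ξ X = star c • vectorSlice a ξ X := by
            rw [vectorSlice, map_smul, map_smulₛₗ, smul_comp]; rfl
          simpa [this] using W.smul_mem (star c) ha }
    have hS : IsClosed (S : Set (HTensor E₁ E₂)) :=
      hW.preimage (f := fun η => vectorSlice η ξ X) (by
        unfold vectorSlice
        exact ((adjoint (𝕜 := ℂ)).continuous.comp (tmulL _ _).continuous).clm_comp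
          continuous_const)
    exact Submodule.eq_top_iff'.mp (htensor_eq_top hS fun η₁ η₂ => hξ η₁ η₂ ξ) η
  exact leftSlices_le hW hη

lemma adjoint_mem_leftSlices {X : HTensor E F →L[ℂ] HTensor E F} {a : F →L[ℂ] F}
    (ha : a ∈ leftSlices X) : adjoint a ∈ leftSlices (adjoint X) := by
  let W : Submodule ℂ (F →L[ℂ] F) :=
    (leftSlices (adjoint X)).comap ((starLinearEquiv ℂ : (F →L[ℂ] F) ≃ₗ⋆[ℂ] _).toLinearMap)
  have hW : IsClosed (W : Set (F →L[ℂ] F)) :=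
    (isClosed_leftSlices (adjoint X)).preimage (f := star) continuous_star
  refine leftSlices_le (X := X) (W := W) hW (fun η ξ => ?_) ha
  change adjoint (vectorSlice η ξ X) ∈ leftSlices (adjoint X)
  rw [adjoint_vectorSlice]
  exact vectorSlice_mem_leftSlices _ _ _

end VectorSlices

/-! ### Leg numbering -/

section Legs

set_option linter.unusedSectionVars false

variable {H : Type*} [NormedAddCommGroup H] [InnerProductSpace ℂ H] [CompleteSpace H]

lemma ext_inner_tmulL {E F : Type*} [NormedAddCommGroup E] [InnerProductSpace ℂ E]
    [NormedAddCommGroup F] [InnerProductSpace ℂ F]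
    {S T : HTensor E F →L[ℂ] HTensor E F}
    (h : ∀ x y x' y', inner ℂ (tmulL E F x y) (S (tmulL E F x' y')) =
      inner ℂ (tmulL E F x y) (T (tmulL E F x' y'))) : S = T := by
  refine htensor_ext fun x' y' => ext_inner_left ℂ fun t => ?_
  have : (innerSL ℂ (S (tmulL E F x' y'))) = innerSL ℂ (T (tmulL E F x' y')) :=
    htensor_ext fun x y => by
      simpa using congr(star $(h x y x' y'))
  simpa using congr(star ($this t))

lemma adjoint_hmap {E F : Type*} [NormedAddCommGroup E] [InnerProductSpace ℂ E] [CompleteSpace E]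
    [NormedAddCommGroup F] [InnerProductSpace ℂ F] [CompleteSpace F]
    (f : E →L[ℂ] E) (g : F →L[ℂ] F) :
    adjoint (hmap f g) = hmap (adjoint f) (adjoint g) :=
  ext_inner_tmulL fun x y x' y' => by
    simp [adjoint_inner_right, inner_tmulL]

variable (H) in
/-- The leg numbering `X ↦ X₁₂ = X ⊗ id` on `(H ⊗ H) ⊗ H`. -/
noncomputable def opLeg₁₂ : (HTensor H H →L[ℂ] HTensor H H) →⋆*
    (HTensor (HTensor H H) H →L[ℂ] HTensor (HTensor H H) H) where
  toFun X := hmap X (ContinuousLinearMap.id ℂ H)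
  map_one' := hmap_id _ _
  map_mul' X Y := hmap_comp X Y (ContinuousLinearMap.id ℂ H) (ContinuousLinearMap.id ℂ H)
  map_star' X := by
    simp only [star_eq_adjoint, adjoint_hmap]
    congr 1
    exact (star_one (H →L[ℂ] H)).symm

variable (H) in
/-- The leg numbering `X ↦ X₂₃ = id ⊗ X`, transported to `(H ⊗ H) ⊗ H` by the associator. -/
noncomputable def opLeg₂₃ : (HTensor H H →L[ℂ] HTensor H H) →⋆*
    (HTensor (HTensor H H) H →L[ℂ] HTensor (HTensor H H) H) where
  toFun X := uop (hassoc H H H).symm ∘L hmap (ContinuousLinearMap.id ℂ H) X ∘L uop (hassoc H H H)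
  map_one' := by
    change _ ∘L hmap (ContinuousLinearMap.id ℂ H) (ContinuousLinearMap.id ℂ _) ∘L _ = _
    rw [hmap_id]
    ext x; simp
  map_mul' X Y := by
    have h := hmap_comp (ContinuousLinearMap.id ℂ H) (ContinuousLinearMap.id ℂ H) X Y
    ext x
    simpa [mul_def] using congr((hassoc H H H).symm ($h (hassoc H H H x)))
  map_star' X := by
    have h : hmap (ContinuousLinearMap.id ℂ H) (adjoint X) =
        adjoint (hmap (ContinuousLinearMap.id ℂ H) X) := by
      rw [adjoint_hmap]
      congr 1
      exact (star_one (H →L[ℂ] H)).symm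
    refine ext fun x => ext_inner_left ℂ fun y => ?_
    simp only [star_eq_adjoint, adjoint_inner_right, h, ContinuousLinearMap.comp_apply]
    change inner ℂ y ((hassoc H H H).symm _) = inner ℂ ((hassoc H H H).symm _) x
    rw [← (hassoc H H H).inner_map_map y, LinearIsometryEquiv.apply_symm_apply,
      ← (hassoc H H H).inner_map_map _ x, LinearIsometryEquiv.apply_symm_apply,
      adjoint_inner_right]
    rfl

lemma opLeg₁₂_tmulL (X : HTensor H H →L[ℂ] HTensor H H) (t : HTensor H H) (z : H) :
    opLeg₁₂ H X (tmulL _ _ t z) = tmulL _ _ (X t) z :=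
  hmap_tmulL _ _ _ _

/-- The operator `y ↦ ξ ⊗ y` from `H ⊗ H` to `(H ⊗ H) ⊗ H`. -/
noncomputable def insertFirst (ξ : H) : HTensor H H →L[ℂ] HTensor (HTensor H H) H :=
  uop (hassoc H H H).symm ∘L tmulL H (HTensor H H) ξ

lemma insertFirst_apply (ξ : H) (t : HTensor H H) :
    insertFirst ξ t = (hassoc H H H).symm (tmulL H (HTensor H H) ξ t) :=
  rfl

lemma opLeg₂₃_apply (X : HTensor H H →L[ℂ] HTensor H H) (t : HTensor (HTensor H H) H) :
    opLeg₂₃ H X t =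
      (hassoc H H H).symm (hmap (ContinuousLinearMap.id ℂ H) X (hassoc H H H t)) :=
  rfl

lemma insertFirst_tmulL (ξ x y : H) :
    insertFirst ξ (tmulL H H x y) = tmulL _ _ (tmulL H H ξ x) y := by
  rw [insertFirst_apply, LinearIsometryEquiv.symm_apply_eq, hassoc_tmulL]

lemma opLeg₂₃_comp_insertFirst (X : HTensor H H →L[ℂ] HTensor H H) (ξ : H) :
    opLeg₂₃ H X ∘L insertFirst ξ = insertFirst ξ ∘L X := by
  refine ContinuousLinearMap.ext fun t => ?_
  rw [ContinuousLinearMap.comp_apply, ContinuousLinearMap.comp_apply, insertFirst_apply,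
    opLeg₂₃_apply, LinearIsometryEquiv.apply_symm_apply, hmap_tmulL, insertFirst_apply]
  rfl

lemma insertFirst_comp_tmulL (ξ₁ ξ₂ : H) :
    insertFirst ξ₁ ∘L tmulL H H ξ₂ = tmulL _ _ (tmulL H H ξ₁ ξ₂) :=
  ext fun x => insertFirst_tmulL ξ₁ ξ₂ x

lemma adjoint_insertFirst_comp_opLeg₁₂ (Z : HTensor H H →L[ℂ] HTensor H H) (η ξ : H) :
    adjoint (insertFirst η) ∘L opLeg₁₂ H Z ∘L insertFirst ξ =
      hmap (vectorSlice η ξ Z) (ContinuousLinearMap.id ℂ H) :=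
  ext_inner_tmulL fun x y x' y' => by
    simp [adjoint_inner_right, insertFirst_tmulL, opLeg₁₂_tmulL, inner_tmulL, inner_vectorSlice]

/-- Slicing `X₂₃ Z₁₂ Y₂₃` first over the first leg replaces `Z` by one of its slices. -/
lemma vectorSlice_sandwich (X Z Y : HTensor H H →L[ℂ] HTensor H H) (η₁ η₂ ξ₁ ξ₂ : H) :
    vectorSlice (tmulL H H η₁ η₂) (tmulL H H ξ₁ ξ₂) (opLeg₂₃ H X * opLeg₁₂ H Z * opLeg₂₃ H Y) =
      vectorSlice η₂ ξ₂ (X * hmap (vectorSlice η₁ ξ₁ Z) (ContinuousLinearMap.id ℂ H) * Y) := by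
  have hX : adjoint (insertFirst η₁) ∘L opLeg₂₃ H X = X ∘L adjoint (insertFirst η₁) := by
    have h := congr(adjoint $(opLeg₂₃_comp_insertFirst (adjoint X) η₁))
    rw [adjoint_comp, adjoint_comp, adjoint_adjoint, ← star_eq_adjoint X, map_star,
      star_eq_adjoint, adjoint_adjoint] at h
    exact h
  have hY := opLeg₂₃_comp_insertFirst Y ξ₁
  rw [← adjoint_insertFirst_comp_opLeg₁₂]
  simp only [vectorSlice, ← insertFirst_comp_tmulL, adjoint_comp, mul_def]
  refine ext fun x => ?_
  have hX' (t) := congr($hX t)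
  have hY' (t) := congr($hY t)
  simp only [ContinuousLinearMap.comp_apply] at hX' hY' ⊢
  rw [hX', hY']

lemma vectorSlice_opLeg₁₂_mul (A Y B) (η ξ : HTensor H H) :
    vectorSlice η ξ (opLeg₁₂ H A * Y * opLeg₁₂ H B) = vectorSlice (star A η) (B ξ) Y := by
  refine ext fun x => ext_inner_left ℂ fun y => ?_
  rw [inner_vectorSlice, inner_vectorSlice, ← opLeg₁₂_tmulL, map_star, star_eq_adjoint,
    adjoint_inner_left]
  simp only [mul_def, ContinuousLinearMap.comp_apply, opLeg₁₂_tmulL]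

/-- Factors acting on the first two legs only do not change the slices over these legs. -/
lemma leftSlices_opLeg₁₂_mul_le (A Y B) :
    leftSlices (opLeg₁₂ H A * Y * opLeg₁₂ H B) ≤ leftSlices Y :=
  leftSlices_le (isClosed_leftSlices Y) fun η ξ => by
    rw [vectorSlice_opLeg₁₂_mul]; exact vectorSlice_mem_leftSlices _ _ _

lemma vectorSlice_opLeg₂₃ (X : HTensor H H →L[ℂ] HTensor H H) (η₁ η₂ ξ₁ ξ₂ : H) :
    vectorSlice (tmulL H H η₁ η₂) (tmulL H H ξ₁ ξ₂) (opLeg₂₃ H X) =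
      inner ℂ η₁ ξ₁ • vectorSlice η₂ ξ₂ X := by
  have h := vectorSlice_sandwich 1 1 X η₁ η₂ ξ₁ ξ₂
  rw [map_one, map_one, one_mul, one_mul, one_mul] at h
  rw [h]
  have h₁ : vectorSlice η₁ ξ₁ (1 : HTensor H H →L[ℂ] HTensor H H) =
      inner ℂ η₁ ξ₁ • ContinuousLinearMap.id ℂ H :=
    ext fun x => ext_inner_left ℂ fun y => by
      simp [inner_vectorSlice, inner_tmulL, inner_smul_right]
  have h₂ : hmap (vectorSlice η₁ ξ₁ (1 : HTensor H H →L[ℂ] HTensor H H))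
      (ContinuousLinearMap.id ℂ H) = inner ℂ η₁ ξ₁ • 1 :=
    htensor_ext fun x y => by simp [h₁]
  rw [h₂, smul_mul_assoc, one_mul]
  simp [vectorSlice]

lemma leftSlices_opLeg₂₃_le (X : HTensor H H →L[ℂ] HTensor H H) :
    leftSlices (opLeg₂₃ H X) ≤ leftSlices X :=
  leftSlices_le_of_tmul (isClosed_leftSlices X) fun η₁ η₂ ξ₁ ξ₂ => by
    rw [vectorSlice_opLeg₂₃]
    exact Submodule.smul_mem _ _ (vectorSlice_mem_leftSlices _ _ _)

lemma leftSlices_opLeg₁₂_mul_opLeg₂₃_mul_le (A X B) :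
    leftSlices (opLeg₁₂ H A * opLeg₂₃ H X * opLeg₁₂ H B) ≤ leftSlices X :=
  (leftSlices_opLeg₁₂_mul_le _ _ _).trans (leftSlices_opLeg₂₃_le X)

end Legs

/-! ### Algebraic relations between the spaces of slices -/

section SliceAlgebra

set_option linter.unusedSectionVars false

variable {H : Type*} [NormedAddCommGroup H] [InnerProductSpace ℂ H] [CompleteSpace H]

lemma norm_hmap_le {E F E' F' : Type*} [NormedAddCommGroup E] [InnerProductSpace ℂ E]
    [NormedAddCommGroup F] [InnerProductSpace ℂ F] [NormedAddCommGroup E']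
    [InnerProductSpace ℂ E'] [NormedAddCommGroup F'] [InnerProductSpace ℂ F']
    (f : E →L[ℂ] E') (g : F →L[ℂ] F') : ‖hmap f g‖ ≤ ‖f‖ * ‖g‖ := by
  refine opNorm_le_bound _ (by positivity) fun t => denseRange_incl.induction_on t
    (isClosed_le (by fun_prop) (by fun_prop)) fun a => ?_
  have h : hmap f g (incl E F a) = incl E' F' (TensorProduct.mapL f g a) :=
    ContinuousLinearMap.completion_apply_coe (TensorProduct.mapL f g) a
  rw [h, LinearIsometry.norm_map, LinearIsometry.norm_map]
  exact (le_opNorm _ _).trans (by gcongr; exact TensorProduct.norm_mapL_le f g)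

variable (H) in
/-- The bounded linear map `k ↦ k ⊗ id`. -/
noncomputable def ampliation : (H →L[ℂ] H) →L[ℂ] (HTensor H H →L[ℂ] HTensor H H) :=
  LinearMap.mkContinuous
    { toFun := fun k => hmap k (ContinuousLinearMap.id ℂ H)
      map_add' := fun k l => htensor_ext fun x y => by simp
      map_smul' := fun c k => htensor_ext fun x y => by simp }
    ‖ContinuousLinearMap.id ℂ H‖ fun k => (norm_hmap_le _ _).trans_eq (mul_comm _ _)

lemma ampliation_apply (k : H →L[ℂ] H) : ampliation H k = hmap k (ContinuousLinearMap.id ℂ H) :=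
  rfl

lemma adjoint_ampliation (k : H →L[ℂ] H) : adjoint (ampliation H k) = ampliation H (adjoint k) := by
  rw [ampliation_apply, adjoint_hmap, ampliation_apply]
  congr 1
  exact star_one (H →L[ℂ] H)

lemma ampliation_rankOne (ζ ζ' : H) :
    ampliation H (rankOne ℂ ζ ζ') = tmulL H H ζ ∘L adjoint (tmulL H H ζ') := by
  refine ext_inner_tmulL fun x y x' y' => ?_
  have h : adjoint (tmulL H H ζ') (tmulL H H x' y') = inner ℂ ζ' x' • y' :=
    ext_inner_left ℂ fun z => by
      rw [adjoint_inner_right, inner_tmulL, inner_smul_right]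
  simp [ampliation_apply, h]

/-- The family of slices of `X₂₃ Z₁₂ Y₂₃` contains `(ω ⊗ id)(X (k ⊗ id) Y)` for each slice `k`
of `Z`. -/
lemma vectorSlice_ampliation_mem {X Y Z : HTensor H H →L[ℂ] HTensor H H}
    {W : Submodule ℂ (H →L[ℂ] H)} (hW : IsClosed (W : Set (H →L[ℂ] H)))
    (h : leftSlices (opLeg₂₃ H X * opLeg₁₂ H Z * opLeg₂₃ H Y) ≤ W)
    {k : H →L[ℂ] H} (hk : k ∈ leftSlices Z) (η ξ : H) :
    vectorSlice η ξ (X * ampliation H k * Y) ∈ W := by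
  let f : (H →L[ℂ] H) →ₗ[ℂ] (H →L[ℂ] H) := (vectorSliceL η ξ).toLinearMap ∘ₗ
    LinearMap.mulRight ℂ Y ∘ₗ LinearMap.mulLeft ℂ X ∘ₗ (ampliation H).toLinearMap
  have hf (k : H →L[ℂ] H) : f k = vectorSlice η ξ (X * ampliation H k * Y) := rfl
  have hc : Continuous f := (vectorSliceL η ξ).continuous.comp
    ((continuous_const.mul (ampliation H).continuous).mul continuous_const)
  have hle : leftSlices Z ≤ W.comap f := leftSlices_le (hW.preimage hc) fun η' ξ' => by
    rw [Submodule.mem_comap, hf, ampliation_apply, ← vectorSlice_sandwich]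
    exact h (vectorSlice_mem_leftSlices _ _ _)
  exact hle hk

lemma leftSlices_sandwich_le {X Y Z : HTensor H H →L[ℂ] HTensor H H}
    {W : Submodule ℂ (H →L[ℂ] H)} (hW : IsClosed (W : Set (H →L[ℂ] H)))
    (h : ∀ k ∈ leftSlices Z, ∀ η ξ, vectorSlice η ξ (X * ampliation H k * Y) ∈ W) :
    leftSlices (opLeg₂₃ H X * opLeg₁₂ H Z * opLeg₂₃ H Y) ≤ W :=
  leftSlices_le_of_tmul hW fun η₁ η₂ ξ₁ ξ₂ => by
    rw [vectorSlice_sandwich]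
    exact h _ (vectorSlice_mem_leftSlices _ _ _) _ _

/-- If the slices of `Z` contain the operators of rank one, then products of slices of `X` and
slices of `Y` are slices of `X₂₃ Z₁₂ Y₂₃`. -/
lemma mul_mem_of_leftSlices_le {X Y Z : HTensor H H →L[ℂ] HTensor H H}
    {W : Submodule ℂ (H →L[ℂ] H)} (hW : IsClosed (W : Set (H →L[ℂ] H)))
    (h : leftSlices (opLeg₂₃ H X * opLeg₁₂ H Z * opLeg₂₃ H Y) ≤ W)
    (hZ : ∀ ζ ζ' : H, rankOne ℂ ζ ζ' ∈ leftSlices Z) {a b : H →L[ℂ] H}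
    (ha : a ∈ leftSlices X) (hb : b ∈ leftSlices Y) : a * b ∈ W := by
  have h₁ (η ζ ζ' ξ : H) : vectorSlice η ζ X * vectorSlice ζ' ξ Y ∈ W := by
    have e : vectorSlice η ζ X * vectorSlice ζ' ξ Y =
        vectorSlice η ξ (X * ampliation H (rankOne ℂ ζ ζ') * Y) := by
      rw [ampliation_rankOne]
      simp only [vectorSlice, mul_def, comp_assoc]
    rw [e]
    exact vectorSlice_ampliation_mem hW h (hZ ζ ζ') η ξ
  have h₂ (ζ' ξ : H) : a * vectorSlice ζ' ξ Y ∈ W := by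
    let f : (H →L[ℂ] H) →ₗ[ℂ] (H →L[ℂ] H) := LinearMap.mulRight ℂ (vectorSlice ζ' ξ Y)
    have hc : Continuous f := continuous_id.mul continuous_const
    have hle : leftSlices X ≤ W.comap f := leftSlices_le (hW.preimage hc) fun η ζ => by
      rw [Submodule.mem_comap, LinearMap.mulRight_apply]
      exact h₁ η ζ ζ' ξ
    exact hle ha
  let g : (H →L[ℂ] H) →ₗ[ℂ] (H →L[ℂ] H) := LinearMap.mulLeft ℂ a
  have hc : Continuous g := continuous_const.mul continuous_id
  have hle : leftSlices Y ≤ W.comap g := leftSlices_le (hW.preimage hc) fun ζ' ξ => by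
    rw [Submodule.mem_comap, LinearMap.mulLeft_apply]
    exact h₂ ζ' ξ
  exact hle hb

end SliceAlgebra

/-! ### Selfadjoint closed subspaces of `C⋆`-algebras -/

/-- A closed subspace `V` of a `C⋆`-algebra with `V⋆ V ⊆ V` and `V V⋆ ⊆ V` is selfadjoint: with
`h = a a⋆` and small `r > 0`, the elements `a⋆ - a⋆ (1 - r h) ^ n` belong to `V` and converge
to `a⋆`. -/
lemma star_mem_of_star_mul_mem {A : Type*} [CStarAlgebra A] {V : Submodule ℂ A}
    (hV : IsClosed (V : Set A)) (h₁ : ∀ a ∈ V, ∀ b ∈ V, star a * b ∈ V)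
    (h₂ : ∀ a ∈ V, ∀ b ∈ V, a * star b ∈ V) {a : A} (ha : a ∈ V) : star a ∈ V := by
  rcases subsingleton_or_nontrivial A with _ | _
  · rw [Subsingleton.elim (star a) 0]; exact V.zero_mem
  set h : A := a * star a with hh
  have hsa : IsSelfAdjoint h := .mul_star_self a
  have hhV : h ∈ V := h₂ a ha a ha
  obtain ⟨r, hr, hr1⟩ : ∃ r : ℝ, 0 < r ∧ r * ‖h‖ ≤ 1 :=
    ⟨(‖h‖ + 1)⁻¹, by positivity, by
      rw [inv_mul_le_one₀ (by positivity)]; linarith⟩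
  let x (n : ℕ) : A := star a * (1 - (r : ℂ) • h) ^ n
  have hx (n : ℕ) : star a - x n ∈ V := by
    induction n with
    | zero => simp [x]
    | succ n ih =>
      have e : star a - x (n + 1) =
          (star a - x n) + (r : ℂ) • (star a * h - (star a - x n) * star h) := by
        simp only [x, pow_succ, hsa.star_eq, ← mul_assoc, mul_sub, sub_mul, mul_one,
          mul_smul_comm, smul_sub]
        abel
      rw [e]
      exact V.add_mem ih (V.smul_mem _ (V.sub_mem (h₁ a ha h hhV) (h₂ _ ih h hhV)))
  have hnorm (n : ℕ) : ‖x n‖ ^ 2 ≤ (r * (2 * n + 1))⁻¹ := by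
    have hs : star (x n) * x n = cfc (fun t : ℝ => (1 - r * t) ^ n * t * (1 - r * t) ^ n) h := by
      rw [cfc_mul .., cfc_mul .., cfc_id' .., cfc_pow .., cfc_sub .., cfc_const_mul .., cfc_id' ..,
        cfc_const_one ..]
      have hg : IsSelfAdjoint ((1 - (r : ℂ) • h) ^ n) :=
        ((IsSelfAdjoint.one A).sub (.smul (by simp [isSelfAdjoint_iff]) hsa)).pow n
      change star (star a * _) * (star a * _) = (1 - (r : ℂ) • h) ^ n * h * (1 - (r : ℂ) • h) ^ n
      rw [star_mul, star_star, hg.star_eq, hh]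
      simp only [mul_assoc]
    rw [sq, ← CStarRing.norm_star_mul_self, hs]
    refine norm_cfc_le (by positivity) fun t ht => ?_
    have ht0 : 0 ≤ t := spectrum_star_mul_self_nonneg (b := star a) t (by rwa [star_star])
    have ht1 : r * t ≤ 1 := by
      have := spectrum.norm_le_norm_of_mem ht
      rw [Real.norm_of_nonneg ht0] at this
      exact (mul_le_mul_of_nonneg_left this hr.le).trans hr1
    have hp : 0 ≤ (1 - r * t) ^ (2 * n) := pow_nonneg (by linarith) _
    have e : (1 - r * t) ^ n * t * (1 - r * t) ^ n = (1 - r * t) ^ (2 * n) * t := by ring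
    rw [e, Real.norm_of_nonneg (by positivity)]
    -- Bernoulli's inequality: `(1 - s) ^ m * (1 + m * s) ≤ (1 - s ^ 2) ^ m ≤ 1`
    have hs0 : 0 ≤ r * t := mul_nonneg hr.le ht0
    have hB := one_add_mul_le_pow (a := r * t) (by linarith) (2 * n)
    have hm : (1 - r * t) ^ (2 * n) * (1 + r * t) ^ (2 * n) ≤ 1 := by
      rw [← mul_pow]
      exact pow_le_one₀ (mul_nonneg (by linarith) (by linarith)) (by nlinarith)
    rw [← one_div, le_div_iff₀ (by positivity)]
    push_cast at hB
    calc (1 - r * t) ^ (2 * n) * t * (r * (2 * n + 1))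
        = (1 - r * t) ^ (2 * n) * (r * t + 2 * n * (r * t)) := by ring
      _ ≤ (1 - r * t) ^ (2 * n) * (1 + r * t) ^ (2 * n) := by gcongr; linarith
      _ ≤ 1 := hm
  have hlim : Filter.Tendsto x Filter.atTop (𝓝 0) := by
    have h₀ : Filter.Tendsto (fun n : ℕ => (r * (2 * n + 1) : ℝ)⁻¹) Filter.atTop (𝓝 0) :=
      (Filter.Tendsto.const_mul_atTop hr (Filter.tendsto_atTop_add_const_right _ _
        (Filter.Tendsto.const_mul_atTop two_pos
          tendsto_natCast_atTop_atTop))).inv_tendsto_atTop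
    have h₃ := (squeeze_zero (fun n => sq_nonneg ‖x n‖) hnorm h₀).sqrt
    simp only [Real.sqrt_sq (norm_nonneg _), Real.sqrt_zero] at h₃
    exact tendsto_zero_iff_norm_tendsto_zero.mpr h₃
  have := (tendsto_const_nhds (x := star a)).sub hlim
  rw [sub_zero] at this
  exact hV.mem_of_tendsto this (Filter.Eventually.of_forall hx)

/-! ### Braided multiplicative unitaries on Hilbert spaces -/

section BraidGroup

variable {G : Type*} [Group G] {f₁ f₂ c₁ c₂ : G}

/-- For `q = f c⁻¹`, the braided pentagon equation becomes `q₂ c₁⁻¹ q₂ = q₁ q₂ q₁`. -/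
lemma braided_pentagon_mul_inv (hp : f₂ * f₁ = f₁ * c₁⁻¹ * f₂ * c₁ * f₂)
    (h₁ : c₂ * c₁ * f₂ = f₁ * c₂ * c₁) (h₂ : c₁ * c₂ * f₁ = f₂ * c₁ * c₂)
    (hc : c₁ * c₂ * c₁ = c₂ * c₁ * c₂) :
    (f₂ * c₂⁻¹) * c₁⁻¹ * (f₂ * c₂⁻¹) = (f₁ * c₁⁻¹) * (f₂ * c₂⁻¹) * (f₁ * c₁⁻¹) := by
  have e₁ : c₂⁻¹ * f₁ * c₁⁻¹ = c₁ * f₂ * (c₁ * c₂ * c₁)⁻¹ := by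
    have : f₁ = c₂ * c₁ * f₂ * c₁⁻¹ * c₂⁻¹ := by rw [h₁]; group
    rw [this]; group
  have e₂ : c₂⁻¹ * c₁⁻¹ * f₂ = f₁ * c₂⁻¹ * c₁⁻¹ := by
    have : f₂ = c₁ * c₂ * f₁ * c₂⁻¹ * c₁⁻¹ := by rw [h₂]; group
    rw [this]; group
  calc (f₂ * c₂⁻¹) * c₁⁻¹ * (f₂ * c₂⁻¹) = f₂ * (c₂⁻¹ * c₁⁻¹ * f₂) * c₂⁻¹ := by group
    _ = (f₂ * f₁) * (c₂ * c₁ * c₂)⁻¹ := by rw [e₂]; group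
    _ = f₁ * c₁⁻¹ * f₂ * (c₁ * f₂ * (c₁ * c₂ * c₁)⁻¹) := by rw [hp, hc]; group
    _ = _ := by rw [← e₁]; group

lemma inv_conj_of_pentagon {q₁ q₂ : G} (hp : q₂ * c₁⁻¹ * q₂ = q₁ * q₂ * q₁) :
    q₂⁻¹ * q₁ * q₂ = c₁⁻¹ * q₂ * q₁⁻¹ := by
  have : q₁ * q₂ = q₂ * c₁⁻¹ * q₂ * q₁⁻¹ := by rw [hp]; group
  rw [mul_assoc, this]; group

lemma conj_inv_of_pentagon {q₁ q₂ : G} (hp : q₂ * c₁⁻¹ * q₂ = q₁ * q₂ * q₁) :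
    q₂ * q₁⁻¹ * q₂⁻¹ = c₁ * q₂⁻¹ * q₁ := by
  have : (q₁⁻¹ * q₂⁻¹) = (q₁ * q₂ * q₁)⁻¹ * q₁ := by group
  rw [mul_assoc, this, ← hp]; group

lemma inv_conj_inv_of_pentagon (hp : f₂ * f₁ = f₁ * c₁⁻¹ * f₂ * c₁ * f₂) :
    f₂⁻¹ * (f₁ * c₁⁻¹)⁻¹ * f₂ = c₁ * f₂ * f₁⁻¹ := by
  have : f₁ * c₁⁻¹ = f₂ * f₁ * (f₂⁻¹ * c₁⁻¹ * f₂⁻¹) := by rw [hp]; group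
  rw [this]; group

end BraidGroup

section HilbertSpace

variable {H : Type*} [NormedAddCommGroup H] [InnerProductSpace ℂ H] [CompleteSpace H]

/-- The relations on `(H ⊗ H) ⊗ H` between a braiding operator `c` and a multiplicative
unitary `f`: the braided pentagon equation, naturality of the braiding with respect to `f` in each
variable, and the braid relation. -/
structure BraidedPentagon (f c : unitary (HTensor H H →L[ℂ] HTensor H H)) : Prop where
  pentagon : Unitary.map (opLeg₂₃ H) f * Unitary.map (opLeg₁₂ H) f =
    Unitary.map (opLeg₁₂ H) f * (Unitary.map (opLeg₁₂ H) c)⁻¹ * Unitary.map (opLeg₂₃ H) f *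
      Unitary.map (opLeg₁₂ H) c * Unitary.map (opLeg₂₃ H) f
  natural_right : Unitary.map (opLeg₂₃ H) c * Unitary.map (opLeg₁₂ H) c *
      Unitary.map (opLeg₂₃ H) f =
    Unitary.map (opLeg₁₂ H) f * Unitary.map (opLeg₂₃ H) c * Unitary.map (opLeg₁₂ H) c
  natural_left : Unitary.map (opLeg₁₂ H) c * Unitary.map (opLeg₂₃ H) c *
      Unitary.map (opLeg₁₂ H) f =
    Unitary.map (opLeg₂₃ H) f * Unitary.map (opLeg₁₂ H) c * Unitary.map (opLeg₂₃ H) c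
  braid : Unitary.map (opLeg₁₂ H) c * Unitary.map (opLeg₂₃ H) c * Unitary.map (opLeg₁₂ H) c =
    Unitary.map (opLeg₂₃ H) c * Unitary.map (opLeg₁₂ H) c * Unitary.map (opLeg₂₃ H) c

/-- The form in which the relations between leg operators are used: if `x₂₃ z₁₂ y₂₃` equals
`a₁₂ t₂₃ b₁₂`, then its slices over the first two legs are slices of `t`. -/
lemma leftSlices_le_of_eq {x y z t a b : unitary (HTensor H H →L[ℂ] HTensor H H)}
    (h : Unitary.map (opLeg₂₃ H) x * Unitary.map (opLeg₁₂ H) z * Unitary.map (opLeg₂₃ H) y =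
      Unitary.map (opLeg₁₂ H) a * Unitary.map (opLeg₂₃ H) t * Unitary.map (opLeg₁₂ H) b) :
    leftSlices (opLeg₂₃ H x * opLeg₁₂ H z * opLeg₂₃ H y) ≤
      leftSlices (t : HTensor H H →L[ℂ] HTensor H H) := by
  have h' : opLeg₂₃ H x * opLeg₁₂ H z * opLeg₂₃ H y = opLeg₁₂ H a * opLeg₂₃ H t * opLeg₁₂ H b :=
    congrArg Subtype.val h
  rw [h']
  exact leftSlices_opLeg₁₂_mul_opLeg₂₃_mul_le _ _ _

namespace BraidedPentagon

variable {f c : unitary (HTensor H H →L[ℂ] HTensor H H)}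

/-- The slices of `f` form an algebra, since `f₂₃ c₁₂ f₂₃ = c₁₂ f₁₂⁻¹ f₂₃ f₁₂` and every operator
of rank one is a slice of `c`. -/
lemma mul_mem_leftSlices (h : BraidedPentagon f c)
    (hc : ∀ ζ ζ' : H, rankOne ℂ ζ ζ' ∈ leftSlices (c : HTensor H H →L[ℂ] HTensor H H))
    {a b : H →L[ℂ] H} (ha : a ∈ leftSlices (f : HTensor H H →L[ℂ] HTensor H H))
    (hb : b ∈ leftSlices (f : HTensor H H →L[ℂ] HTensor H H)) :
    a * b ∈ leftSlices (f : HTensor H H →L[ℂ] HTensor H H) := by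
  refine mul_mem_of_leftSlices_le (isClosed_leftSlices _)
    (leftSlices_le_of_eq (a := c * f⁻¹) (b := f) ?_) hc ha hb
  rw [map_mul, map_inv, mul_assoc (_ * _) _ (Unitary.map (opLeg₁₂ H) f), h.pentagon]
  group

end BraidedPentagon

lemma star_mem_leftSlices_inv {u : unitary (HTensor H H →L[ℂ] HTensor H H)} {a : H →L[ℂ] H}
    (ha : a ∈ leftSlices (u : HTensor H H →L[ℂ] HTensor H H)) :
    star a ∈ leftSlices ((u⁻¹ : unitary _) : HTensor H H →L[ℂ] HTensor H H) :=
  adjoint_mem_leftSlices ha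

lemma rankOne_mem_leftSlices_inv {u : unitary (HTensor H H →L[ℂ] HTensor H H)}
    (hu : ∀ ζ ζ' : H, rankOne ℂ ζ ζ' ∈ leftSlices (u : HTensor H H →L[ℂ] HTensor H H)) (ζ ζ' : H) :
    rankOne ℂ ζ ζ' ∈ leftSlices ((u⁻¹ : unitary _) : HTensor H H →L[ℂ] HTensor H H) := by
  rw [← adjoint_rankOne]
  exact star_mem_leftSlices_inv (hu ζ' ζ)

/-- If `q₂₃ c₁₂⁻¹ q₂₃ = q₁₂ q₂₃ q₁₂`, then the slices of `q` form a selfadjoint space as soon as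
they contain the operators of rank one, because both `q₂₃⁻¹ q₁₂ q₂₃` and `q₂₃ q₁₂⁻¹ q₂₃⁻¹` are
expressed through a single factor acting on the third leg. -/
lemma star_mem_leftSlices_of_pentagon {q c : unitary (HTensor H H →L[ℂ] HTensor H H)}
    (hp : Unitary.map (opLeg₂₃ H) q * (Unitary.map (opLeg₁₂ H) c)⁻¹ * Unitary.map (opLeg₂₃ H) q =
      Unitary.map (opLeg₁₂ H) q * Unitary.map (opLeg₂₃ H) q * Unitary.map (opLeg₁₂ H) q)
    (hq : ∀ ζ ζ' : H, rankOne ℂ ζ ζ' ∈ leftSlices (q : HTensor H H →L[ℂ] HTensor H H))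
    {a : H →L[ℂ] H} (ha : a ∈ leftSlices (q : HTensor H H →L[ℂ] HTensor H H)) :
    star a ∈ leftSlices (q : HTensor H H →L[ℂ] HTensor H H) := by
  have h₁ := leftSlices_le_of_eq (x := q⁻¹) (z := q) (y := q) (t := q) (a := c⁻¹) (b := q⁻¹)
    (by simpa only [map_inv] using inv_conj_of_pentagon hp)
  have h₂ := leftSlices_le_of_eq (x := q) (z := q⁻¹) (y := q⁻¹) (t := q⁻¹) (a := c) (b := q)
    (by simpa only [map_inv] using conj_inv_of_pentagon hp)
  have m₁ {a b : H →L[ℂ] H} (ha : a ∈ leftSlices (q : HTensor H H →L[ℂ] HTensor H H))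
      (hb : b ∈ leftSlices (q : HTensor H H →L[ℂ] HTensor H H)) :
      star a * b ∈ leftSlices (q : HTensor H H →L[ℂ] HTensor H H) :=
    mul_mem_of_leftSlices_le (isClosed_leftSlices _) h₁ hq (star_mem_leftSlices_inv ha) hb
  have m₂ {a b : H →L[ℂ] H} (ha : a ∈ leftSlices (q : HTensor H H →L[ℂ] HTensor H H))
      (hb : b ∈ leftSlices (q : HTensor H H →L[ℂ] HTensor H H)) :
      a * star b ∈ leftSlices (q : HTensor H H →L[ℂ] HTensor H H) := by
    have h₃ := star_mem_leftSlices_inv (mul_mem_of_leftSlices_le (isClosed_leftSlices _) h₂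
      (rankOne_mem_leftSlices_inv hq) hb (star_mem_leftSlices_inv ha))
    have e : star (b * star a) = a * star b := by rw [star_mul, star_star]
    rwa [inv_inv, e] at h₃
  exact star_mem_of_star_mul_mem (isClosed_leftSlices _) (fun a ha b hb => m₁ ha hb)
    (fun a ha b hb => m₂ ha hb) ha

lemma vectorSlice_mem_leftSlices_opLeg₂₃ {e : H} (he : ‖e‖ = 1)
    (X : HTensor H H →L[ℂ] HTensor H H) (η ξ : H) :
    vectorSlice η ξ X ∈ leftSlices (opLeg₂₃ H X) := by
  have h := vectorSlice_opLeg₂₃ X e η e ξ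
  rw [inner_self_eq_norm_sq_to_K, he] at h
  simp only [RCLike.ofReal_one, one_pow, one_smul] at h
  rw [← h]
  exact vectorSlice_mem_leftSlices _ _ _

lemma leftSlices_le_leftSlices_opLeg₂₃ (X : HTensor H H →L[ℂ] HTensor H H) :
    leftSlices X ≤ leftSlices (opLeg₂₃ H X) := by
  rcases subsingleton_or_nontrivial H with _ | _
  · intro a _
    rw [show a = 0 from ContinuousLinearMap.ext fun x => Subsingleton.elim _ _]
    exact Submodule.zero_mem _
  · obtain ⟨e, he⟩ := exists_norm_eq H zero_le_one
    exact leftSlices_le (isClosed_leftSlices _) (vectorSlice_mem_leftSlices_opLeg₂₃ he X)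

lemma adjoint_vectorSlice_ampliation (f : unitary (HTensor H H →L[ℂ] HTensor H H))
    (k : H →L[ℂ] H) (η ξ : H) :
    star (vectorSlice η ξ (((f⁻¹ : unitary _) : HTensor H H →L[ℂ] HTensor H H) *
        ampliation H k * (f : HTensor H H →L[ℂ] HTensor H H))) =
      vectorSlice ξ η (((f⁻¹ : unitary _) : HTensor H H →L[ℂ] HTensor H H) *
        ampliation H (star k) * (f : HTensor H H →L[ℂ] HTensor H H)) := by
  have hf : ((f⁻¹ : unitary _) : HTensor H H →L[ℂ] HTensor H H) = star (f : _ →L[ℂ] _) := rfl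
  rw [star_eq_adjoint, adjoint_vectorSlice, ← star_eq_adjoint, hf, star_mul, star_mul, star_star,
    star_eq_adjoint (ampliation H k), adjoint_ampliation, ← star_eq_adjoint k, ← mul_assoc]

namespace BraidedPentagon

variable {f c : unitary (HTensor H H →L[ℂ] HTensor H H)}

/-- If the slices of `q = f c⁻¹` contain the operators of rank one, then the slices of `f` form a
selfadjoint space: as `f₂₃⁻¹ q₁₂⁻¹ f₂₃ = c₁₂ f₂₃ f₁₂⁻¹`, they are spanned by the slices of
`f⁻¹ (k ⊗ id) f` with `k` in the selfadjoint space of slices of `q⁻¹`. -/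
lemma star_mem_leftSlices (h : BraidedPentagon f c)
    (hq : ∀ ζ ζ' : H, rankOne ℂ ζ ζ' ∈
      leftSlices ((f * c⁻¹ : unitary _) : HTensor H H →L[ℂ] HTensor H H))
    {a : H →L[ℂ] H} (ha : a ∈ leftSlices (f : HTensor H H →L[ℂ] HTensor H H)) :
    star a ∈ leftSlices (f : HTensor H H →L[ℂ] HTensor H H) := by
  have hp := braided_pentagon_mul_inv h.pentagon h.natural_right h.natural_left h.braid
  have hr := inv_conj_inv_of_pentagon h.pentagon
  rw [← map_inv, ← map_inv, ← map_mul, ← map_mul] at hp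
  rw [← map_inv (Unitary.map (opLeg₁₂ H)) c, ← map_mul] at hr
  generalize f * c⁻¹ = q at hp hr hq
  rw [map_inv] at hp
  have hstar {k : H →L[ℂ] H}
      (hk : k ∈ leftSlices ((q⁻¹ : unitary _) : HTensor H H →L[ℂ] HTensor H H)) :
      star k ∈ leftSlices ((q⁻¹ : unitary _) : HTensor H H →L[ℂ] HTensor H H) := by
    have h₁ := star_mem_leftSlices_inv hk
    rw [inv_inv] at h₁
    have h₂ := star_mem_leftSlices_inv (star_mem_leftSlices_of_pentagon hp hq h₁)
    rwa [star_star] at h₂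
  have hle := leftSlices_le_of_eq (x := f⁻¹) (z := q⁻¹) (y := f) (t := f) (a := c) (b := f⁻¹)
    (by simpa only [map_inv] using hr)
  -- the closed subspace of all `a` with `star a` a slice of `f`
  let W : Submodule ℂ (H →L[ℂ] H) :=
    (leftSlices (f : HTensor H H →L[ℂ] HTensor H H)).comap
      ((starLinearEquiv ℂ : (H →L[ℂ] H) ≃ₗ⋆[ℂ] _).toLinearMap)
  have hW : IsClosed (W : Set (H →L[ℂ] H)) :=
    (isClosed_leftSlices (f : HTensor H H →L[ℂ] HTensor H H)).preimage (f := star) continuous_star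
  have hWmem (a : H →L[ℂ] H) :
      a ∈ W ↔ star a ∈ leftSlices (f : HTensor H H →L[ℂ] HTensor H H) := Iff.rfl
  have hsand := leftSlices_sandwich_le (X := (f⁻¹ : unitary _)) (Z := (q⁻¹ : unitary _))
    (Y := (f : HTensor H H →L[ℂ] HTensor H H)) hW fun k hk η ξ => by
      rw [hWmem, adjoint_vectorSlice_ampliation]
      exact vectorSlice_ampliation_mem (isClosed_leftSlices _) hle (hstar hk) ξ η
  have e : opLeg₂₃ H (f : HTensor H H →L[ℂ] HTensor H H) =
      opLeg₁₂ H ((c⁻¹ : unitary _) : HTensor H H →L[ℂ] HTensor H H) *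
        (opLeg₂₃ H ((f⁻¹ : unitary _) : HTensor H H →L[ℂ] HTensor H H) *
          opLeg₁₂ H ((q⁻¹ : unitary _) : HTensor H H →L[ℂ] HTensor H H) *
          opLeg₂₃ H (f : HTensor H H →L[ℂ] HTensor H H)) *
        opLeg₁₂ H (f : HTensor H H →L[ℂ] HTensor H H) := by
    have e' : Unitary.map (opLeg₂₃ H) f = Unitary.map (opLeg₁₂ H) c⁻¹ *
        (Unitary.map (opLeg₂₃ H) f⁻¹ * Unitary.map (opLeg₁₂ H) q⁻¹ * Unitary.map (opLeg₂₃ H) f) *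
        Unitary.map (opLeg₁₂ H) f := by
      rw [map_inv, map_inv, map_inv, hr]; group
    exact congrArg Subtype.val e'
  have hl := leftSlices_opLeg₁₂_mul_le ((c⁻¹ : unitary _) : HTensor H H →L[ℂ] HTensor H H)
    (opLeg₂₃ H ((f⁻¹ : unitary _) : HTensor H H →L[ℂ] HTensor H H) *
      opLeg₁₂ H ((q⁻¹ : unitary _) : HTensor H H →L[ℂ] HTensor H H) *
      opLeg₂₃ H (f : HTensor H H →L[ℂ] HTensor H H)) (f : HTensor H H →L[ℂ] HTensor H H)
  rw [← e] at hl
  exact (hWmem a).mp (hsand (hl (leftSlices_le_leftSlices_opLeg₂₃ _ ha)))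

end BraidedPentagon

lemma isCompactOperator_rankOne {H : Type*} [NormedAddCommGroup H] [InnerProductSpace ℂ H]
    (ζ ζ' : H) : IsCompactOperator (rankOne ℂ ζ ζ') := by
  have h : IsCompactOperator (toSpanSingleton ℂ ζ : ℂ → H) :=
    isCompactOperator_of_locallyCompactSpace_rng (toSpanSingleton ℂ ζ)
  exact h.comp_clm (innerSL ℂ ζ')

/-- The space of slices of a unitary acts non-degenerately. -/
lemma topologicalClosure_span_leftSlices_apply (f : unitary (HTensor H H →L[ℂ] HTensor H H)) :
    (Submodule.span ℂ {η : H | ∃ a ∈ leftSlices (f : HTensor H H →L[ℂ] HTensor H H), ∃ ξ : H,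
      η = a ξ}).topologicalClosure = ⊤ := by
  rw [Submodule.topologicalClosure_eq_top_iff, Submodule.eq_bot_iff]
  intro y hy
  have h₀ (η : H) : star (f : HTensor H H →L[ℂ] HTensor H H) (tmulL H H η y) = 0 := by
    have : innerSL ℂ (star (f : HTensor H H →L[ℂ] HTensor H H) (tmulL H H η y)) = 0 :=
      htensor_ext fun ξ x => by
        rw [innerSL_apply_apply, star_eq_adjoint, adjoint_inner_left, ← inner_vectorSlice]
        exact (Submodule.mem_orthogonal' _ _).mp hy _
          (Submodule.subset_span ⟨_, vectorSlice_mem_leftSlices _ _ _, x, rfl⟩)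
    exact inner_self_eq_zero.mp congr($this _)
  have h₁ : tmulL H H y y = 0 := by
    have := congr((f : HTensor H H →L[ℂ] HTensor H H) $(h₀ y))
    rwa [map_zero, ← ContinuousLinearMap.comp_apply, ← mul_def,
      Unitary.mul_star_self_of_mem f.2] at this
  have h₂ := inner_tmulL y y y y
  rw [h₁, inner_zero_left] at h₂
  simpa using h₂.symm

end HilbertSpace

/-! ### Leg operators in a concrete monoidal `W⋆`-category -/

section Concrete

open Functor.LaxMonoidal Functor.OplaxMonoidal CStarCategory

universe v u w

variable {C : Type u} [Category.{v} C] [MonoidalCategory C]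

section Braided

variable [BraidedCategory C] {L : C} (F : L ⊗ L ⟶ L ⊗ L)

lemma leg₂₃_natural :
    leg₂₃ F ≫ leg₁₂ (β_ L L).hom ≫ leg₂₃ (β_ L L).hom =
      leg₁₂ (β_ L L).hom ≫ leg₂₃ (β_ L L).hom ≫ leg₁₂ F := by
  have h : leg₁₂ (β_ L L).hom ≫ leg₂₃ (β_ L L).hom =
      (α_ L L L).hom ≫ (β_ L (L ⊗ L)).hom := by
    rw [BraidedCategory.braiding_tensor_right_hom]; simp [leg₁₂, leg₂₃]
  rw [h, reassoc_of% h, leg₁₂, leg₂₃]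
  simp only [Category.assoc, Iso.inv_hom_id_assoc, BraidedCategory.braiding_naturality_right]

lemma leg₁₂_natural :
    leg₁₂ F ≫ leg₂₃ (β_ L L).hom ≫ leg₁₂ (β_ L L).hom =
      leg₂₃ (β_ L L).hom ≫ leg₁₂ (β_ L L).hom ≫ leg₂₃ F := by
  have h : leg₂₃ (β_ L L).hom ≫ leg₁₂ (β_ L L).hom =
      (β_ (L ⊗ L) L).hom ≫ (α_ L L L).inv := by
    rw [BraidedCategory.braiding_tensor_left_hom]; simp [leg₁₂, leg₂₃]
  rw [h, reassoc_of% h, leg₁₂, leg₂₃, BraidedCategory.braiding_naturality_left_assoc,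
    Iso.inv_hom_id_assoc]

variable (L) in
lemma leg_braid :
    leg₁₂ (β_ L L).hom ≫ leg₂₃ (β_ L L).hom ≫ leg₁₂ (β_ L L).hom =
      leg₂₃ (β_ L L).hom ≫ leg₁₂ (β_ L L).hom ≫ leg₂₃ (β_ L L).hom :=
  leg₁₂_natural (β_ L L).hom

end Braided

variable [MonoidalWStarCategory C] (U : FibreFunctor.{w} C) {L : C}

lemma HilbCat.operator_comp {H K M : HilbCat.{w}} (f : H ⟶ K) (g : K ⟶ M) :
    HilbCat.operator (f ≫ g) = HilbCat.operator g ∘L HilbCat.operator f :=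
  rfl

lemma FibreFunctor.onTensor_comp (f g : L ⊗ L ⟶ L ⊗ L) :
    U.onTensor (f ≫ g) = U.onTensor g * U.onTensor f := by
  rw [mul_def, onTensor, onTensor, onTensor, ← HilbCat.operator_comp]
  simp

lemma FibreFunctor.onTensor_id : U.onTensor (𝟙 (L ⊗ L)) = 1 := by
  rw [onTensor, CategoryTheory.Functor.map_id, Category.id_comp, Functor.Monoidal.μ_δ]
  rfl

lemma FibreFunctor.onTensor_adj (f : L ⊗ L ⟶ L ⊗ L) :
    U.onTensor (adj f) = star (U.onTensor f) := by
  simp only [onTensor, HilbCat.operator_comp, star_eq_adjoint, U.map_adj]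
  rw [← U.adjoint_μ]
  simp only [adjoint_comp, adjoint_adjoint, comp_assoc]

/-- The unitary operator underlying a unitary endomorphism of `L ⊗ L`. -/
noncomputable def FibreFunctor.unitaryOnTensor {f : L ⊗ L ⟶ L ⊗ L} (hf : IsUnitaryHom f) :
    unitary (HTensor (U.space L) (U.space L) →L[ℂ] HTensor (U.space L) (U.space L)) :=
  ⟨U.onTensor f, by
    rw [Unitary.mem_iff, ← U.onTensor_adj, ← U.onTensor_comp, ← U.onTensor_comp, hf.1, hf.2,
      U.onTensor_id]
    exact ⟨rfl, rfl⟩⟩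

/-- The operator on `(H ⊗ H) ⊗ H`, where `H` is the Hilbert space of `L`, underlying an
endomorphism of `(L ⊗ L) ⊗ L`. -/
noncomputable def FibreFunctor.onTriple (f : (L ⊗ L) ⊗ L ⟶ (L ⊗ L) ⊗ L) :
    HTensor (HTensor (U.space L) (U.space L)) (U.space L) →L[ℂ]
      HTensor (HTensor (U.space L) (U.space L)) (U.space L) :=
  HilbCat.operator ((μ U.functor L L ▷ U.functor.obj L ≫ μ U.functor (L ⊗ L) L) ≫
    U.functor.map f ≫ (δ U.functor (L ⊗ L) L ≫ δ U.functor L L ▷ U.functor.obj L))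

lemma FibreFunctor.onTriple_comp (f g : (L ⊗ L) ⊗ L ⟶ (L ⊗ L) ⊗ L) :
    U.onTriple (f ≫ g) = U.onTriple g * U.onTriple f := by
  rw [mul_def, onTriple, onTriple, onTriple, ← HilbCat.operator_comp]
  simp

lemma FibreFunctor.onTriple_leg₁₂ (f : L ⊗ L ⟶ L ⊗ L) :
    U.onTriple (leg₁₂ f) = opLeg₁₂ (U.space L) (U.onTensor f) := by
  have h : (μ U.functor L L ▷ U.functor.obj L ≫ μ U.functor (L ⊗ L) L) ≫
      U.functor.map (leg₁₂ f) ≫ (δ U.functor (L ⊗ L) L ≫ δ U.functor L L ▷ U.functor.obj L) =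
      (μ U.functor L L ≫ U.functor.map f ≫ δ U.functor L L) ▷ U.functor.obj L := by
    simp [leg₁₂, ← Functor.LaxMonoidal.μ_natural_left_assoc]
  rw [onTriple, h]
  rfl

lemma FibreFunctor.onTriple_leg₂₃ (f : L ⊗ L ⟶ L ⊗ L) :
    U.onTriple (leg₂₃ f) = opLeg₂₃ (U.space L) (U.onTensor f) := by
  have h₁ : (μ U.functor L L ▷ U.functor.obj L ≫ μ U.functor (L ⊗ L) L) ≫
      U.functor.map (α_ L L L).hom = (α_ _ _ _).hom ≫ U.functor.obj L ◁ μ U.functor L L ≫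
        μ U.functor L (L ⊗ L) := by
    rw [Category.assoc, Functor.LaxMonoidal.associativity]
  have h₂ : U.functor.map (α_ L L L).inv ≫
      (δ U.functor (L ⊗ L) L ≫ δ U.functor L L ▷ U.functor.obj L) =
      δ U.functor L (L ⊗ L) ≫ U.functor.obj L ◁ δ U.functor L L ≫ (α_ _ _ _).inv := by
    rw [Functor.OplaxMonoidal.associativity_inv]
  have h : (μ U.functor L L ▷ U.functor.obj L ≫ μ U.functor (L ⊗ L) L) ≫
      U.functor.map (leg₂₃ f) ≫ (δ U.functor (L ⊗ L) L ≫ δ U.functor L L ▷ U.functor.obj L) =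
      (α_ _ _ _).hom ≫ U.functor.obj L ◁ (μ U.functor L L ≫ U.functor.map f ≫ δ U.functor L L) ≫
        (α_ _ _ _).inv := by
    rw [leg₂₃, Functor.map_comp, Functor.map_comp]
    simp only [Category.assoc] at h₁ h₂ ⊢
    rw [h₂, reassoc_of% h₁]
    simp only [← Functor.LaxMonoidal.μ_natural_right_assoc, Functor.Monoidal.μ_δ_assoc,
      MonoidalCategory.whiskerLeft_comp, Category.assoc]
  rw [onTriple, h]
  rfl

variable [BraidedCategory C]

lemma adj_braiding_hom (hc : IsUnitaryHom (β_ L L).hom) : adj (β_ L L).hom = (β_ L L).inv := by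
  rw [← cancel_epi (β_ L L).hom, hc.1, Iso.hom_inv_id]

/-- A multiplicative unitary in a concrete category with unitary braiding satisfies the braided
pentagon relations on the underlying Hilbert spaces. -/
lemma IsMultiplicativeUnitary.braidedPentagon {F : L ⊗ L ⟶ L ⊗ L} (hF : IsMultiplicativeUnitary F)
    (hc : IsUnitaryHom (β_ L L).hom) :
    BraidedPentagon (U.unitaryOnTensor hF.unitary) (U.unitaryOnTensor hc) where
  pentagon := by
    refine Subtype.ext ?_
    have h := congr(U.onTriple $(hF.pentagon))
    rw [← adj_braiding_hom hc] at h
    simp only [U.onTriple_comp, U.onTriple_leg₁₂, U.onTriple_leg₂₃, U.onTensor_adj] at h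
    rw [← map_inv]
    exact h
  natural_right := by
    refine Subtype.ext ?_
    have h := congr(U.onTriple $(leg₂₃_natural F))
    simp only [U.onTriple_comp, U.onTriple_leg₁₂, U.onTriple_leg₂₃] at h
    exact h
  natural_left := by
    refine Subtype.ext ?_
    have h := congr(U.onTriple $(leg₁₂_natural F))
    simp only [U.onTriple_comp, U.onTriple_leg₁₂, U.onTriple_leg₂₃] at h
    exact h
  braid := by
    refine Subtype.ext ?_
    have h := congr(U.onTriple $(leg_braid L))
    simp only [U.onTriple_comp, U.onTriple_leg₁₂, U.onTriple_leg₂₃] at h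
    exact h

end Concrete

end BraidedMU

open BraidedMU CategoryTheory MonoidalCategory in
/-- The leg algebra `A(F)` of a multiplicative unitary in a bi-semi-regularly braided concrete
monoidal `W⋆`-category is a non-degenerate subalgebra, and a `C⋆`-algebra if `F` is
bi-semi-regular. -/
theorem mainTheorem12 {C : Type*} [Category* C] [MonoidalCategory C]
    [MonoidalWStarCategory C] [BraidedCategory C] (U : FibreFunctor C)
    (hc : IsBiSemiRegularBraiding U) (L : C) (F : L ⊗ L ⟶ L ⊗ L)
    (hF : IsMultiplicativeUnitary F) :
    (∃ S : NonUnitalSubalgebra ℂ (U.space L →L[ℂ] U.space L),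
      (S : Set (U.space L →L[ℂ] U.space L)) = legAlgebra U F) ∧
    (Submodule.span ℂ {η : U.space L | ∃ a ∈ legAlgebra U F, ∃ ξ : U.space L,
      η = a ξ}).topologicalClosure = ⊤ ∧
    (IsBiSemiRegular U F →
      ∃ S : NonUnitalStarSubalgebra ℂ (U.space L →L[ℂ] U.space L),
        (S : Set (U.space L →L[ℂ] U.space L)) = legAlgebra U F ∧
        IsClosed (S : Set (U.space L →L[ℂ] U.space L))) := by
  have hcL := hc.unitary L L
  have hP := hF.braidedPentagon U hcL
  have hmul {a b : U.space L →L[ℂ] U.space L} (ha : a ∈ legAlgebra U F)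
      (hb : b ∈ legAlgebra U F) : a * b ∈ legAlgebra U F :=
    hP.mul_mem_leftSlices
      (fun ζ ζ' => hc.compact_mem_op L L _ (isCompactOperator_rankOne ζ ζ')) ha hb
  let S : NonUnitalSubalgebra ℂ (U.space L →L[ℂ] U.space L) :=
    { (legAlgebra U F).toAddSubmonoid with
      mul_mem' := hmul
      smul_mem' := fun c _ ha => (legAlgebra U F).smul_mem c ha }
  refine ⟨⟨S, rfl⟩,
    topologicalClosure_span_leftSlices_apply (U.unitaryOnTensor hF.unitary), fun hR => ?_⟩
  -- the operators of rank one are slices of `q⋆`, where `q = F c⁻¹`, hence also of `q`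
  have hq (ζ ζ' : U.space L) : InnerProductSpace.rankOne ℂ ζ ζ' ∈
      leftSlices (((U.unitaryOnTensor hF.unitary * (U.unitaryOnTensor hcL)⁻¹ : unitary _)) :
        HTensor (U.space L) (U.space L) →L[ℂ] HTensor (U.space L) (U.space L)) := by
    have h := rankOne_mem_leftSlices_inv
      (u := U.unitaryOnTensor hcL * (U.unitaryOnTensor hF.unitary)⁻¹) (fun ζ ζ' => by
        have h := hR.compact_mem_op _ (isCompactOperator_rankOne ζ ζ')
        rw [U.onTensor_comp, U.onTensor_adj] at h
        exact h) ζ ζ'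
    rwa [mul_inv_rev, inv_inv] at h
  exact ⟨{ S with star_mem' := fun ha => hP.star_mem_leftSlices hq ha }, rfl,
    isClosed_leftSlices _⟩
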